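/- Let $\mathcal H$ be a complex Hilbert space, $H_0$ a self-adjoint operator on $\mathcal H$ with domain $\mathcal D$, and $V$ a self-adjoint operator which is relatively compact with respect to $H_0$: $\mathcal D\subset \mathrm{dom}\,V$ and $(H_0-z)^{-1}V$ is compact (that is, extends to a compact operator on $\mathcal H$) for some $z$ outside the spectrum of $H_0$. For $s\in\mathbb C$ let $H_s=H_0+sV$, with domain $\mathcal D$. Let $\lambda$ be a real number outside the essential spectrum of $H_0$, and assume that $V$ is a regular direction: $\lambda$ is not an eigenvalue of $H_s$ for at least one real $s$. A number $s\in\mathbb C$ is called a resonance point if $\lambda$ is an eigenvalue of $H_s$; otherwise let $A_\lambda(s)=(H_s-\lambda)^{-1}V$, extended to a bounded operator on $\mathcal H$. Let $r_\lambda\in\mathbb R$ be a resonance point. A vector $\chi\in\mathcal H$ is a resonance vector if $(1+(r_\lambda-s)A_\lambda(s))^k\chi=0$ for some integer $k\ge 1$ and some $s$ that is not a resonance point. Put $$\mathbf A_\lambda(r_\lambda)=\frac1{2\pi i}\oint_{C}(s-r_\lambda)A_\lambda(s)\,ds,$$ where $C$ is a circle centred at $r_\lambda$, of positive radius, such that $r_\lambda$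 is the only resonance point on or inside $C$. A resonance vector $\chi$ has depth at least $1$ if $\chi=\mathbf A_\lambda(r_\lambda)\chi_1$ for some resonance vector $\chi_1$. Let $\mathcal V_\lambda=\{x\in\mathcal D: H_{r_\lambda}x=\lambda x\}$, let $\hat P$ be the orthogonal projection onto $\mathcal V_\lambda^\perp$, let $\hat H_{r_\lambda}$ be the operator $\hat PH_{r_\lambda}$ in $\mathcal V_\lambda^\perp$ with domain $\mathcal D\cap\mathcal V_\lambda^\perp$, let $R_\lambda(\hat H_{r_\lambda})$ be its resolvent $(\hat H_{r_\lambda}-\lambda)^{-1}$ on $\mathcal V_\lambda^\perp$, extended by zero on $\mathcal V_\lambda$, and let $S_\lambda=R_\lambda(\hat H_{r_\lambda})V$ on $\mathrm{dom}\,V$. **Theorem.** Circles $C$ as above exist. Every resonance vector $\chi$ belongs to $\mathrm{dom}\,V$, and, for every such circle $C$, the following assertions are equivalent: 1. $V\chi$ is orthogonal to $\mathcal V_\lambda$; 2. $\chi$ has depth at least $1$; 3. $\mathbf A_\lambda(r_\lambda)S_\lambda\chi=-\chi$. In particular, if $V\chi\perp\mathcal V_\lambda$, then $S_\lambda\chi$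 is a resonance vector. -/

import Mathlib

noncomputable section

namespace Resonance

variable {E : Type*} [NormedAddCommGroup E] [InnerProductSpace ℂ E]

/-- The operator `T - z`, on the domain of `T`. -/
def subScalar (T : E →ₗ.[ℂ] E) (z : ℂ) : T.domain →ₗ[ℂ] E :=
  T.toFun - z • T.domain.subtype

/-- `R` is the bounded everywhere defined two-sided inverse of `T - z`. -/
def IsInverseAt (T : E →ₗ.[ℂ] E) (z : ℂ) (R : E →L[ℂ] E) : Prop :=
  (∀ x : T.domain, R (subScalar T z x) = x) ∧
    ∀ y : E, ∃ x : T.domain, (x : E) = R y ∧ subScalar T z x = y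

/-- The resolvent set of an unbounded operator; its complement is the spectrum. -/
def resolventSet (T : E →ₗ.[ℂ] E) : Set ℂ := {z | ∃ R : E →L[ℂ] E, IsInverseAt T z R}

open Classical in
/-- The resolvent `R_z(T) = (T - z)⁻¹` (by convention `0` if `z` is in the spectrum). -/
def resolvent (T : E →ₗ.[ℂ] E) (z : ℂ) : E →L[ℂ] E :=
  if h : ∃ R : E →L[ℂ] E, IsInverseAt T z R then h.choose else 0

/-- The eigenspace `{x ∈ dom T : T x = z x}`, as a subspace of `E`. -/
def eigenspace (T : E →ₗ.[ℂ] E) (z : ℂ) : Submodule ℂ E :=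
  (LinearMap.ker (subScalar T z)).map T.domain.subtype

/-- The essential spectrum of a self-adjoint operator: the numbers `z` for which `T - z` is not a
Fredholm operator. -/
def essentialSpectrum (T : E →ₗ.[ℂ] E) : Set ℂ :=
  {z | ¬ (FiniteDimensional ℂ (LinearMap.ker (subScalar T z)) ∧
    IsClosed (LinearMap.range (subScalar T z) : Set E) ∧
    FiniteDimensional ℂ (E ⧸ LinearMap.range (subScalar T z)))}

/-- The operator `K` is bounded, everywhere defined, and extends the product `R V`, which is defined
on the domain of `V`. -/
def ExtendsProduct (R : E →L[ℂ] E) (V : E →ₗ.[ℂ] E) (K : E →L[ℂ] E) : Prop :=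
  ∀ x : V.domain, K x = R (V x)

open Classical in
/-- The product `R V` as a bounded operator on `E`, that is, the bounded extension of `R V` from the
domain of `V` (unique if `V` is densely defined; by convention `0` if there is none). -/
def boundedProduct (R : E →L[ℂ] E) (V : E →ₗ.[ℂ] E) : E →L[ℂ] E :=
  if h : ∃ K : E →L[ℂ] E, ExtendsProduct R V K then h.choose else 0

/-- `V` is relatively compact with respect to `H₀`: `dom H₀ ⊆ dom V`, and `(H₀ - z)⁻¹ V` is compact
for some `z` outside the spectrum of `H₀`. -/
def IsRelativelyCompact (H₀ V : E →ₗ.[ℂ] E) : Prop :=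
  H₀.domain ≤ V.domain ∧
    ∃ z ∈ resolventSet H₀, ∃ K : E →L[ℂ] E,
      ExtendsProduct (resolvent H₀ z) V K ∧ IsCompactOperator K

/-- The line of operators `H_s = H₀ + s V`, with domain `dom H₀ ∩ dom V`. -/
def line (H₀ V : E →ₗ.[ℂ] E) (s : ℂ) : E →ₗ.[ℂ] E := H₀ + s • V

/-- `s` is a resonance point of the triple `(z; H₀, V)`: `z` is an eigenvalue of `H_s`. -/
def IsResonancePoint (H₀ V : E →ₗ.[ℂ] E) (z s : ℂ) : Prop :=
  eigenspace (line H₀ V s) z ≠ ⊥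

/-- `V` is a regular direction: the real line `H₀ + s V` does not consist entirely of operators
for which `lam` is an eigenvalue. -/
def IsRegularDirection (H₀ V : E →ₗ.[ℂ] E) (lam : ℝ) : Prop :=
  ∃ s : ℝ, ¬ IsResonancePoint H₀ V lam s

/-- The operator `A_z(s) = R_z(H_s) V`. -/
def opA (H₀ V : E →ₗ.[ℂ] E) (z s : ℂ) : E →L[ℂ] E :=
  boundedProduct (resolvent (line H₀ V s) z) V

/-- `χ` is a resonance vector at `r`: `(1 + (r - s) A_z(s))ᵏ χ = 0` for some `k ≥ 1`, where `s` is
some number that is not a resonance point. -/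
def IsResonanceVector (H₀ V : E →ₗ.[ℂ] E) (z r : ℂ) (χ : E) : Prop :=
  ∃ s : ℂ, ¬ IsResonancePoint H₀ V z s ∧
    ∃ k : ℕ, 0 < k ∧ ((1 + (r - s) • opA H₀ V z s) ^ k) χ = 0

/-- The circle of radius `ρ` about `r` has no resonance point on it or inside it, except possibly
for `r` itself. -/
def IsIsolatingRadius (H₀ V : E →ₗ.[ℂ] E) (z r : ℂ) (ρ : ℝ) : Prop :=
  0 < ρ ∧ ∀ s ∈ Metric.closedBall r ρ, IsResonancePoint H₀ V z s → s = r

/-- The nilpotent operator `𝐀_z(r) = (2πi)⁻¹ ∮ (s - r) A_z(s) ds`, the contour being the circle of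
radius `ρ` about `r`. -/
def nilpotentA (H₀ V : E →ₗ.[ℂ] E) (z r : ℂ) (ρ : ℝ) : E →L[ℂ] E :=
  (2 * Real.pi * Complex.I : ℂ)⁻¹ • ∮ s in C(r, ρ), (s - r) • opA H₀ V z s

/-- `χ` has depth at least `k`: `χ = 𝐀_z(r)ᵏ χ₁` for some resonance vector `χ₁`. -/
def HasDepthAtLeast (H₀ V : E →ₗ.[ℂ] E) (z r : ℂ) (ρ : ℝ) (k : ℕ) (χ : E) : Prop :=
  ∃ χ₁ : E, IsResonanceVector H₀ V z r χ₁ ∧ (nilpotentA H₀ V z r ρ ^ k) χ₁ = χ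

/-- The compression of `T` to the subspace `K`: the operator `P_K T` with domain `K ∩ dom T`, as an
operator in `K`. -/
def compression (T : E →ₗ.[ℂ] E) (K : Submodule ℂ E) [K.HasOrthogonalProjection] :
    K →ₗ.[ℂ] K where
  domain := T.domain.comap K.subtype
  toFun := (K.orthogonalProjectionOnto : E →ₗ[ℂ] K) ∘ₗ T.toFun ∘ₗ
    (K.subtype.restrict (p := T.domain.comap K.subtype) (q := T.domain) fun _ hx => hx)

/-- The sliced resolvent `R_z(Ĥ_r)`: the resolvent at `z` of the compression `Ĥ_r` of `H_r` to the
orthogonal complement of the eigenspace `{x : H_r x = z x}`, extended by `0` to that eigenspace. -/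
def slicedResolvent [CompleteSpace E] (H₀ V : E →ₗ.[ℂ] E) (z r : ℂ) : E →L[ℂ] E :=
  let K : Submodule ℂ E := (eigenspace (line H₀ V r) z)ᗮ
  K.subtypeL ∘L resolvent (compression (line H₀ V r) K) z ∘L K.orthogonalProjectionOnto

/-- The operator `S_z = R_z(Ĥ_r) V`, on the domain of `V`. -/
def opS [CompleteSpace E] (H₀ V : E →ₗ.[ℂ] E) (z r : ℂ) : E →ₗ.[ℂ] E :=
  (slicedResolvent H₀ V z r : E →ₗ[ℂ] E).compPMap V

end Resonance

end

/-! Fix a real non-resonant `s₀`, and put `G = (H_{s₀} - λ)⁻¹`, `T = V G`, and `A` the bounded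
extension of `G V`. Both `A` and `T` are compact, and `A = T*` (`exists_isBasePoint`). On domains,
`G (H_s - λ) = 1 + (s - s₀) A` and `(H_s - λ) G = 1 + (s - s₀) T`, so the unbounded problem becomes
one about a linear pencil of compact operators. With `B = 1 + (r - s₀) A`, the eigenspace of `H_r`
is `ker B`, and the resonance vectors are the generalized kernel of `B`. They lie in the range of
`G`, hence in all the domains involved (`mem_range_of_pow_eq_zero`).

Let `P` be the Riesz projection of `B` at `0`, and `J` the inverse of `A` on the range of `P`,
extended by zero. Then `B J` is nilpotent, and the Laurent expansion of `A_λ(s) = (1 + (s - s₀) A)⁻¹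
A` at `r` gives `𝐀 = -B J` (`laurent`, `circleIntegral_eq`).

The equivalences are then algebra. If `Vχ ⊥ ker (H_r - λ)`, then `y = S_λ χ` solves `(H_r - λ) y =
Vχ`; applying `G` gives `B y = A χ`, whence `𝐀 y = -J A χ = -P χ = -χ`. Since `𝐀 = 𝐀 P`, that
identity exhibits `χ` as `𝐀` of a resonance vector. Finally, `χ = 𝐀 χ₁` gives `A χ = -B χ₁`, that
is, `G V χ = -G (H_r - λ) χ₁`; as `G` is injective, `Vχ` lies in the range of `H_r - λ`, which is
orthogonal to the eigenspace by symmetry. -/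

open scoped InnerProductSpace

/-! ### Riesz theory of compact perturbations of the identity -/

section Compact

variable {E : Type*} [NormedAddCommGroup E] [InnerProductSpace ℂ E] [CompleteSpace E]

omit [CompleteSpace E] in
theorem ContinuousLinearMap.eq_zero_of_isUnit {T : E →L[ℂ] E} (hT : IsUnit T) {x : E}
    (hx : T x = 0) : x = 0 := by
  obtain ⟨u, rfl⟩ := hT
  calc x = (↑u⁻¹ * ↑u : E →L[ℂ] E) x := by rw [Units.inv_mul]; rfl
    _ = (↑u⁻¹ : E →L[ℂ] E) ((u : E →L[ℂ] E) x) := rfl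
    _ = 0 := by rw [hx, map_zero]

/-- The Fredholm alternative for a compact perturbation of the identity. -/
theorem IsCompactOperator.isUnit_one_add {K : E →L[ℂ] E} (hK : IsCompactOperator K)
    (hinj : ∀ x, (1 + K) x = 0 → x = 0) : IsUnit (1 + K) := by
  rcases hK.hasEigenvalue_or_mem_resolventSet (μ := -1) (by simp) with h | h
  · obtain ⟨x, hx⟩ := h.exists_hasEigenvector
    refine absurd (hinj x ?_) hx.2
    have := hx.apply_eq_smul
    simp only [ContinuousLinearMap.coe_coe] at this
    simp [this]
  · rw [spectrum.mem_resolventSet_iff, ← IsUnit.neg_iff] at h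
    convert h using 1
    ext x; simp [add_comm]

/-- Since `‖T* u‖² ≤ ‖T T* u‖ ‖u‖` and `T T*` is compact, a finite net for the image of the unit
ball under `T T*` yields one for its image under `T*`. -/
theorem IsCompactOperator.adjoint {T : E →L[ℂ] E} (hT : IsCompactOperator T) :
    IsCompactOperator (ContinuousLinearMap.adjoint T) := by
  have hTT : IsCompactOperator (T ∘L ContinuousLinearMap.adjoint T) :=
    hT.comp_clm (ContinuousLinearMap.adjoint T)
  have h1 := (isCompactOperator_iff_isCompact_closure_image_ball
    ((T ∘L ContinuousLinearMap.adjoint T : E →L[ℂ] E) : E →ₗ[ℂ] E) one_pos).1 hTT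
  refine (isCompactOperator_iff_isCompact_closure_image_ball
    (ContinuousLinearMap.adjoint T : E →ₗ[ℂ] E) one_pos).2 ?_
  refine (TotallyBounded.closure ?_).isCompact_of_isClosed isClosed_closure
  have h2 := h1.totallyBounded.subset subset_closure
  rw [Metric.totallyBounded_iff]
  intro ε hε
  -- Differences of points of the unit ball have norm at most `2`, so mesh `ε² / 2` for `T T*` gives
  -- mesh `ε` for `T*`.
  obtain ⟨t, hts, htf, htc⟩ := totallyBounded_iff_subset.1 h2 _
    (Metric.dist_mem_uniformity (show 0 < ε ^ 2 / 2 by positivity))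
  have hts' : ∀ y ∈ t, ∃ x : E, x ∈ Metric.ball (0 : E) 1 ∧
      (T ∘L ContinuousLinearMap.adjoint T) x = y := fun y hy => hts hy
  choose! g hg1 hg2 using hts'
  refine ⟨(fun y => ContinuousLinearMap.adjoint T (g y)) '' t, htf.image _, ?_⟩
  rintro _ ⟨x, hx, rfl⟩
  have := htc (Set.mem_image_of_mem _ hx)
  simp only [Set.mem_iUnion] at this
  obtain ⟨y, hy, hxy⟩ := this
  simp only [Set.mem_iUnion]
  refine ⟨_, Set.mem_image_of_mem _ hy, ?_⟩
  have hgy1 := hg1 y hy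
  have hgy2 := hg2 y hy
  simp only [ContinuousLinearMap.coe_coe, ContinuousLinearMap.comp_apply, Set.mem_ofPred_eq,
    Metric.mem_ball, dist_zero_right] at *
  rw [← hgy2, dist_eq_norm] at hxy
  rw [dist_eq_norm]
  set u := x - g y with hu
  have hun : ‖u‖ ≤ 2 := (norm_sub_le _ _).trans (by linarith)
  rw [← map_sub] at hxy ⊢
  rw [← map_sub, ← hu] at hxy
  rw [← hu]
  have h3 : ‖ContinuousLinearMap.adjoint T u‖ ^ 2 ≤
      ‖T (ContinuousLinearMap.adjoint T u)‖ * ‖u‖ := by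
    have h4 : (⟪T (ContinuousLinearMap.adjoint T u), u⟫_ℂ) =
        ((‖ContinuousLinearMap.adjoint T u‖ ^ 2 : ℝ) : ℂ) := by
      rw [← ContinuousLinearMap.adjoint_inner_right, inner_self_eq_norm_sq_to_K]; simp
    have h5 := norm_inner_le_norm (𝕜 := ℂ) (T (ContinuousLinearMap.adjoint T u)) u
    rw [h4, Complex.norm_real, Real.norm_of_nonneg (by positivity)] at h5
    exact h5
  have h6 : ‖ContinuousLinearMap.adjoint T u‖ ^ 2 < ε ^ 2 := by
    nlinarith [norm_nonneg (T (ContinuousLinearMap.adjoint T u)), norm_nonneg u]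
  exact lt_of_pow_lt_pow_left₀ 2 hε.le h6

-- On this kernel `K` acts as `-1`, so the identity of the kernel is compact.
omit [CompleteSpace E] in
theorem IsCompactOperator.finiteDimensional_ker_one_add {K : E →L[ℂ] E}
    (hK : IsCompactOperator K) :
    FiniteDimensional ℂ (LinearMap.ker ((1 + K : E →L[ℂ] E) : E →ₗ[ℂ] E)) := by
  set N := LinearMap.ker ((1 + K : E →L[ℂ] E) : E →ₗ[ℂ] E) with hN
  have hx : ∀ x ∈ N, (K : E →ₗ[ℂ] E) x = -x := fun x hx => by
    have : x + K x = 0 := by simpa [hN] using hx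
    simpa using eq_neg_of_add_eq_zero_right this
  have hmaps : ∀ x ∈ N, (K : E →ₗ[ℂ] E) x ∈ N := fun x h => by
    rw [hx x h]; exact N.neg_mem h
  have hc : IsCompactOperator ((K : E →ₗ[ℂ] E).restrict hmaps) :=
    IsCompactOperator.restrict (f := (K : E →ₗ[ℂ] E)) hK hmaps
      (ContinuousLinearMap.isClosed_ker (1 + K))
  refine FiniteDimensional.of_isCompactOperator_id (𝕜 := ℂ) ?_
  have := hc.neg
  have e : (id : N → N) = -((K : E →ₗ[ℂ] E).restrict hmaps : N → N) := by
    funext x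
    exact Subtype.ext (by simp [LinearMap.restrict_apply, hx x x.2])
  rw [e]
  exact this

omit [CompleteSpace E] in
theorem IsCompactOperator.exists_one_add_pow {K : E →L[ℂ] E} (hK : IsCompactOperator K) (n : ℕ) :
    ∃ K' : E →L[ℂ] E, IsCompactOperator K' ∧ (1 + K) ^ n = 1 + K' := by
  induction n with
  | zero => exact ⟨0, isCompactOperator_zero, by simp⟩
  | succ n ih =>
    obtain ⟨K', hK', h⟩ := ih
    refine ⟨K' + (1 + K') * K, IsCompactOperator.add hK' (hK.clm_comp (1 + K') :), ?_⟩
    rw [pow_succ, h]; noncomm_ring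

/-- If the kernels grew strictly forever, unit vectors of each one orthogonal to the preceding one
would have images under `K` at mutual distance at least `1`, contradicting compactness. -/
theorem IsCompactOperator.exists_ker_pow_stable {K : E →L[ℂ] E} (hK : IsCompactOperator K) :
    ∃ k : ℕ, ∀ x, ((1 + K) ^ (k + 1)) x = 0 → ((1 + K) ^ k) x = 0 := by
  by_contra! hcon
  have key : ∀ n : ℕ, ∃ y : E, ‖y‖ = 1 ∧ ((1 + K) ^ (n + 1)) y = 0 ∧
      ∀ z, ((1 + K) ^ n) z = 0 → 1 ≤ ‖y - z‖ := by
    intro n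
    obtain ⟨x, hx, hx'⟩ := hcon n
    set N := LinearMap.ker (((1 + K) ^ n : E →L[ℂ] E) : E →ₗ[ℂ] E) with hN
    have : CompleteSpace N := (ContinuousLinearMap.isClosed_ker ((1 + K) ^ n)).completeSpace_coe
    have hp : ((1 + K) ^ n) (N.starProjection x) = 0 :=
      LinearMap.mem_ker.1 (N.starProjection_apply_mem x)
    set w := x - N.starProjection x with hw
    have hw0 : w ≠ 0 := fun h => hx' (by rw [sub_eq_zero.1 h]; exact hp)
    have hwk : ((1 + K) ^ (n + 1)) w = 0 := by
      rw [hw, map_sub, hx, pow_succ', mul_apply_eq_comp, hp]; simp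
    have hwo : ∀ z, ((1 + K) ^ n) z = 0 → ⟪w, z⟫_ℂ = 0 := fun z hz =>
      Submodule.inner_left_of_mem_orthogonal (K := N) (LinearMap.mem_ker.2 hz)
        (N.sub_starProjection_mem_orthogonal x)
    have hwn : (0 : ℝ) < ‖w‖ := norm_pos_iff.2 hw0
    refine ⟨((‖w‖⁻¹ : ℝ) : ℂ) • w, ?_, by rw [map_smul, hwk, smul_zero], fun z hz => ?_⟩
    · rw [norm_smul, Complex.norm_real, Real.norm_of_nonneg (by positivity)]
      field_simp
    · have h1 : ⟪w, ((‖w‖⁻¹ : ℝ) : ℂ) • w - z⟫_ℂ = ((‖w‖ : ℝ) : ℂ) := by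
        rw [inner_sub_right, hwo z hz, inner_smul_right, inner_self_eq_norm_sq_to_K]
        simp only [Complex.ofReal_inv, Complex.coe_algebraMap, sub_zero]
        have : (‖w‖ : ℂ) ≠ 0 := by exact_mod_cast hwn.ne'
        field_simp
      have h2 := norm_inner_le_norm (𝕜 := ℂ) w (((‖w‖⁻¹ : ℝ) : ℂ) • w - z)
      rw [h1, Complex.norm_real, Real.norm_of_nonneg hwn.le] at h2
      exact le_of_mul_le_mul_left (by linarith) hwn
  choose f hf1 hf2 hf3 using key
  have hmono : ∀ {m n : ℕ} {x : E}, m ≤ n → ((1 + K) ^ m) x = 0 → ((1 + K) ^ n) x = 0 := by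
    intro m n x hmn h
    rw [← Nat.sub_add_cancel hmn, pow_add, mul_apply_eq_comp, h, map_zero]
  have hfar : ∀ {m n : ℕ}, m < n → 1 ≤ ‖K (f n) - K (f m)‖ := by
    intro m n hmn
    have hz : ((1 + K) ^ n) ((1 + K) (f n) - (1 + K) (f m) + f m) = 0 := by
      rw [map_add, map_sub, ← mul_apply_eq_comp, ← mul_apply_eq_comp,
        ← pow_succ, hf2 n, hmono (by omega) (hf2 m), hmono (by omega) (hf2 m)]; simp
    have := hf3 n _ hz
    rw [← norm_neg] at this
    refine this.trans_eq (congrArg norm ?_)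
    change -(f n - (f n + K (f n) - (f m + K (f m)) + f m)) = _
    abel
  obtain ⟨S, hS, hS'⟩ := hK.image_closedBall_subset_compact (f := (K : E →ₗ[ℂ] E)) 1
  obtain ⟨y, -, ψ, hψ, hψy⟩ := hS.tendsto_subseq (x := fun n => K (f n))
    (fun n => hS' ⟨f n, by simp [hf1], rfl⟩)
  obtain ⟨N, hN⟩ := Metric.cauchySeq_iff'.1 hψy.cauchySeq 1 one_pos
  have := hN (N + 1) (by omega)
  rw [dist_eq_norm] at this
  exact absurd this (not_lt.2 (hfar (hψ (Nat.lt_succ_self N))))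

/-- `P` is the Riesz projection of `B` at `0`: the projection onto the kernel of `B ^ k` along the
range of `B ^ k`. -/
structure IsRieszProjection (B P : E →L[ℂ] E) (k : ℕ) : Prop where
  apply_of_ker : ∀ j x, (B ^ j) x = 0 → P x = x
  pow_mul : B ^ k * P = 0
  mul_pow : P * B ^ k = 0
  exists_eq : ∀ y, ∃ x, y = P y + (B ^ k) x
  comm : ∀ C, Commute B C → Commute P C

omit [CompleteSpace E] in
theorem IsRieszProjection.mul_self {B P : E →L[ℂ] E} {k : ℕ} (h : IsRieszProjection B P k) :
    P * P = P := by
  ext x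
  refine h.apply_of_ker k _ ?_
  simpa using congrArg (fun T : E →L[ℂ] E => T x) h.pow_mul

/-- The Riesz decomposition of a compact perturbation of the identity. -/
theorem IsCompactOperator.exists_isRieszProjection {K : E →L[ℂ] E} (hK : IsCompactOperator K) :
    ∃ k₀ : ℕ, 0 < k₀ ∧ ∀ k, k₀ ≤ k → ∃ P, IsRieszProjection (1 + K) P k := by
  obtain ⟨k₁, hk₁⟩ := hK.exists_ker_pow_stable
  set B := 1 + K with hB
  have hst : ∀ n x, (B ^ (k₁ + n)) x = 0 → (B ^ k₁) x = 0 := by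
    intro n
    induction n with
    | zero => intro x hx; simpa using hx
    | succ n ih =>
      intro x hx
      refine ih x ?_
      have h1 : (B ^ (k₁ + 1)) ((B ^ n) x) = 0 := by
        rw [← mul_apply_eq_comp, ← pow_add]
        rwa [show k₁ + 1 + n = k₁ + (n + 1) by ring]
      have := hk₁ _ h1
      rwa [← mul_apply_eq_comp, ← pow_add] at this
  refine ⟨k₁ + 1, by omega, fun k hk => ?_⟩
  have hker : ∀ j x, (B ^ j) x = 0 → (B ^ k) x = 0 := by
    intro j x hx
    have h1 : (B ^ (k₁ + j)) x = 0 := by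
      rw [pow_add, mul_apply_eq_comp, hx, map_zero]
    have h2 := hst j x h1
    rw [show k = (k - k₁) + k₁ by omega, pow_add, mul_apply_eq_comp, h2, map_zero]
  have hdisj : ∀ x, (B ^ k) ((B ^ k) x) = 0 → (B ^ k) x = 0 := fun x hx =>
    hker (k + k) x (by rwa [pow_add, mul_apply_eq_comp])
  obtain ⟨K', hK', hK'e⟩ := hK.exists_one_add_pow k
  rw [← hB] at hK'e
  have hfd := hK'.finiteDimensional_ker_one_add
  rw [← hK'e] at hfd
  -- The kernel and range of `B ^ k` meet trivially, so adding the finite-rank projection onto the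
  -- kernel makes `B ^ k` injective, hence invertible by the Fredholm alternative. Its inverse
  -- splits every vector into a kernel part and a range part.
  set N := LinearMap.ker ((B ^ k : E →L[ℂ] E) : E →ₗ[ℂ] E) with hN
  have memN : ∀ x, x ∈ N ↔ (B ^ k) x = 0 := fun x => LinearMap.mem_ker
  set p := N.starProjection with hp
  have hpN : ∀ x, (B ^ k) (p x) = 0 := fun x => (memN _).1 (N.starProjection_apply_mem x)
  have hpid : ∀ x, (B ^ k) x = 0 → p x = x := fun x hx =>
    Submodule.starProjection_eq_self_iff.2 ((memN x).2 hx)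
  have hpc : IsCompactOperator p :=
    by
    have : LocallyCompactSpace N := @locallyCompact_of_proper _ _ (FiniteDimensional.proper ℂ N)
    exact (isCompactOperator_id.comp_clm
      N.orthogonalProjectionOnto).clm_comp N.subtypeL
  have hU : IsUnit (B ^ k + p) := by
    rw [hK'e, add_assoc]
    refine (hK'.add hpc).isUnit_one_add fun x hx => ?_
    change (1 + (K' + p)) x = 0 at hx
    rw [← add_assoc, ← hK'e, add_apply] at hx
    have h1 : (B ^ k) x = 0 := hdisj x (by
      rw [eq_neg_of_add_eq_zero_left hx, map_neg, hpN, neg_zero])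
    rw [h1, zero_add, hpid x h1] at hx
    exact hx
  obtain ⟨u, hu⟩ := hU
  have hdec : ∀ y, y = (B ^ k) ((↑u⁻¹ : E →L[ℂ] E) y) + p ((↑u⁻¹ : E →L[ℂ] E) y) := fun y => by
    have : (B ^ k + p) ((↑u⁻¹ : E →L[ℂ] E) y) = y := by
      rw [← hu, ← mul_apply_eq_comp, Units.mul_inv]; rfl
    rw [← add_apply, this]
  have huniq : ∀ a x, (B ^ k) a = 0 → a = (B ^ k) x → a = 0 := fun a x h1 h2 => by
    rw [h2]; exact hdisj x (by rw [← h2, h1])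
  set P : E →L[ℂ] E := p * (↑u⁻¹ : E →L[ℂ] E) with hP
  have hPy : ∀ y, ∃ x, y = P y + (B ^ k) x := fun y =>
    ⟨(↑u⁻¹ : E →L[ℂ] E) y, by rw [add_comm]; exact hdec y⟩
  have hPN : ∀ y, (B ^ k) (P y) = 0 := fun y => hpN _
  have hPeq : ∀ n x, (B ^ k) n = 0 → P (n + (B ^ k) x) = n := by
    intro n x hn
    obtain ⟨z, hz⟩ := hPy (n + (B ^ k) x)
    have := huniq (n - P (n + (B ^ k) x)) (z - x) (by rw [map_sub, hn, hPN, sub_zero]) (by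
      rw [map_sub, sub_eq_sub_iff_add_eq_add, add_comm ((B ^ k) z), ← hz])
    exact (sub_eq_zero.1 this).symm
  refine ⟨P, fun j x hx => ?_, ?_, ?_, hPy, fun C hC => ?_⟩
  · simpa using hPeq x 0 (hker j x hx)
  · ext x; exact hPN x
  · ext x; simpa using hPeq 0 x (map_zero _)
  · have hC' : ∀ x, (B ^ k) (C x) = C ((B ^ k) x) := fun x =>
      congrArg (fun T : E →L[ℂ] E => T x) (hC.pow_left k).eq
    ext y
    obtain ⟨x, hx⟩ := hPy y
    change P (C y) = C (P y)
    conv_lhs => rw [hx]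
    rw [map_add, ← hC', hPeq _ _ (by rw [hC', hPN, map_zero])]

end Compact

/-! ### Laurent expansion and residue of the pencil -/

section Laurent

variable {E : Type*} [NormedAddCommGroup E] [InnerProductSpace ℂ E]
  {A P : E →L[ℂ] E} {r s₀ : ℂ} {k : ℕ}

/-- The inverse of `A` on the range of the Riesz projection `P` of `1 + σ A`, extended by `0`. -/
noncomputable def rieszInverse (A P : E →L[ℂ] E) (σ : ℂ) (k : ℕ) : E →L[ℂ] E :=
  -(σ • ((∑ j ∈ Finset.range k, (1 + σ • A) ^ j) * P))

theorem commute_one_add_smul_self (A : E →L[ℂ] E) (a : ℂ) : Commute (1 + a • A) A :=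
  (Commute.one_left _).add_left ((Commute.refl A).smul_left a)

namespace IsRieszProjection

theorem commute {σ : ℂ} (h : IsRieszProjection (1 + σ • A) P k) : Commute P A :=
  h.comm A (commute_one_add_smul_self A σ)

theorem commute_self {B : E →L[ℂ] E} (h : IsRieszProjection B P k) : Commute P B :=
  h.comm B (Commute.refl B)

/-- Since `σ A = B - 1` with `B = 1 + σ A`, the geometric sum telescopes to `(1 - B ^ k) P`, and `B
^ k P = 0`. -/
theorem mul_rieszInverse {σ : ℂ} (h : IsRieszProjection (1 + σ • A) P k) :
    A * rieszInverse A P σ k = P := by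
  have h1 : A * rieszInverse A P σ k =
      -((((1 + σ • A) - 1) * ∑ j ∈ Finset.range k, (1 + σ • A) ^ j) * P) := by
    rw [rieszInverse, mul_neg, mul_smul_comm, add_sub_cancel_left, smul_mul_assoc, smul_mul_assoc,
      mul_assoc]
  rw [h1, mul_geom_sum, sub_mul, h.pow_mul, one_mul, zero_sub, neg_neg]

theorem commute_rieszInverse {σ : ℂ} (h : IsRieszProjection (1 + σ • A) P k) {C : E →L[ℂ] E}
    (hC : Commute A C) : Commute (rieszInverse A P σ k) C := by
  have h1 : Commute (1 + σ • A) C := (Commute.one_left _).add_left (hC.smul_left σ)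
  exact (((Commute.sum_left _ _ _ fun j _ => h1.pow_left j).mul_left (h.comm C h1)).smul_left
    σ).neg_left

theorem rieszInverse_mul_proj {σ : ℂ} (h : IsRieszProjection (1 + σ • A) P k) :
    rieszInverse A P σ k * P = rieszInverse A P σ k := by
  rw [rieszInverse, neg_mul, smul_mul_assoc, mul_assoc, h.mul_self]

theorem isNilpotent_mul_rieszInverse {σ : ℂ} (h : IsRieszProjection (1 + σ • A) P k)
    (hk : 0 < k) : ((1 + σ • A) * rieszInverse A P σ k) ^ k = 0 := by
  have hc := h.commute_rieszInverse (commute_one_add_smul_self A σ).symm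
  set X := (1 + σ • A) * rieszInverse A P σ k with hX
  have hXP : X * P = X := by rw [hX, mul_assoc, h.rieszInverse_mul_proj]
  have h1 : X ^ k = X ^ k * P := by
    obtain ⟨n, rfl⟩ : ∃ n, k = n + 1 := ⟨k - 1, by omega⟩
    rw [pow_succ, mul_assoc, hXP]
  rw [h1, hX, ← hc.eq, hc.mul_pow, mul_assoc, h.pow_mul, mul_zero]

theorem mul_mul_rieszInverse {σ : ℂ} (h : IsRieszProjection (1 + σ • A) P k) :
    A * ((1 + σ • A) * rieszInverse A P σ k) = (1 + σ • A) * P := by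
  rw [← mul_assoc, ← (commute_one_add_smul_self A σ).eq, mul_assoc, h.mul_rieszInverse]

/-- The reduced pencil: it agrees with `1 + (s - s₀) A` on the kernel of `P`, and with `1` on its
range. -/
theorem reduced_mul {σ : ℂ} (h : IsRieszProjection (1 + σ • A) P k) (c : ℂ) :
    (1 + c • (A * (1 - P))) * (1 - P) = (1 + c • A) * (1 - P) := by
  rw [add_mul, add_mul, smul_mul_assoc, smul_mul_assoc, mul_assoc A]
  congr 3
  simp [mul_sub, sub_mul, h.mul_self]

/-- A kernel vector `x` has `P x = 0`, so it lies in the kernel of `1 + c A`. This kernel is zero in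
the first case and inside the range of `P` in the second. Invertibility thus persists at `s = r`. -/
theorem isUnit_reduced [CompleteSpace E] {σ c : ℂ} (hA : IsCompactOperator A)
    (h : IsRieszProjection (1 + σ • A) P k)
    (hc : (∀ x, (1 + c • A) x = 0 → x = 0) ∨ c = σ) :
    IsUnit (1 + c • (A * (1 - P))) := by
  refine IsCompactOperator.isUnit_one_add (K := c • (A * (1 - P)))
    (IsCompactOperator.smul (f := (A * (1 - P) : E →L[ℂ] E)) (hA.comp_clm (1 - P)) c)
    fun x hx => ?_
  have hPP : ∀ y, P (P y) = P y := fun y => congrArg (fun T : E →L[ℂ] E => T y) h.mul_self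
  have hPA : ∀ y, P (A y) = A (P y) := fun y => congrArg (fun T : E →L[ℂ] E => T y) h.commute.eq
  have hx' : x + c • A (x - P x) = 0 := hx
  have hPx : P x = 0 := by
    have := congrArg P hx'
    simpa [hPA, hPP] using this
  rw [hPx, sub_zero] at hx'
  rcases hc with hc | rfl
  · exact hc x hx'
  · have := h.apply_of_ker 1 x (by rw [pow_one]; exact hx')
    rw [← this, hPx]

/-- This is what isolates resonance points: if `x` were a kernel vector with `P x ≠ 0`, then `r - s
≠ 0` would be an eigenvalue of the nilpotent `B J`; and if `P x = 0`, the reduced pencil kills `x`.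
-/
theorem injective_of_isUnit_reduced (h : IsRieszProjection (1 + (r - s₀) • A) P k) (hk : 0 < k)
    {s : ℂ} (hs : s ≠ r) (hu : IsUnit (1 + (s - s₀) • (A * (1 - P)))) (x : E)
    (hx : (1 + (s - s₀) • A) x = 0) : x = 0 := by
  set B := 1 + (r - s₀) • A with hB
  set J := rieszInverse A P (r - s₀) k with hJ
  have hPA : ∀ y, P (A y) = A (P y) := fun y => congrArg (fun T : E →L[ℂ] E => T y) h.commute.eq
  have hx' : x + (s - s₀) • A x = 0 := hx
  have hPx : P x + (s - s₀) • A (P x) = 0 := by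
    have := congrArg P hx'
    simpa [hPA] using this
  have hJA : ∀ y, J (A y) = P y := fun y => by
    rw [← h.mul_rieszInverse, ← (h.commute_rieszInverse (Commute.refl A)).eq]; rfl
  have hPP : ∀ y, P (P y) = P y := fun y => congrArg (fun T : E →L[ℂ] E => T y) h.mul_self
  have hX : (B * J) (P x) = (r - s) • P x := by
    have h1 : B (P x) = (r - s) • A (P x) := by
      change P x + (r - s₀) • A (P x) = _
      linear_combination (norm := module) hPx
    rw [← (h.commute_rieszInverse (commute_one_add_smul_self A _).symm).eq]
    change J (B (P x)) = _
    rw [h1, map_smul, hJA, hPP]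
  have hXn : ∀ n : ℕ, ((B * J) ^ n) (P x) = (r - s) ^ n • P x := by
    intro n
    induction n with
    | zero => simp
    | succ n ih =>
      rw [pow_succ, mul_apply_eq_comp, hX, map_smul, ih, smul_smul, pow_succ']
  have hP0 : P x = 0 := by
    have := hXn k
    rw [h.isNilpotent_mul_rieszInverse hk] at this
    exact (smul_eq_zero.1 this.symm).resolve_left (pow_ne_zero _ (sub_ne_zero.2 hs.symm))
  refine ContinuousLinearMap.eq_zero_of_isUnit hu ?_
  change x + (s - s₀) • A (x - P x) = 0
  rw [hP0, sub_zero, hx']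

/-- The Laurent expansion of `(1 + (s - s₀) A)⁻¹ A` at `s = r`. -/
theorem laurent (h : IsRieszProjection (1 + (r - s₀) • A) P k) (hk : 0 < k)
    {s : ℂ} (hs : s ≠ r) (hM : IsUnit (1 + (s - s₀) • A))
    (hu : IsUnit (1 + (s - s₀) • (A * (1 - P)))) {F : E →L[ℂ] E}
    (hF : (1 + (s - s₀) • A) * F = A) :
    F = (s - r)⁻¹ • ((∑ j ∈ Finset.range k,
          (-((s - r)⁻¹ • ((1 + (r - s₀) • A) * rieszInverse A P (r - s₀) k))) ^ j) * P) +
        Ring.inverse (1 + (s - s₀) • (A * (1 - P))) * (A * (1 - P)) := by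
  refine hM.mul_left_cancel ?_
  set B := 1 + (r - s₀) • A with hB
  set J := rieszInverse A P (r - s₀) k with hJ
  set C := 1 + (s - s₀) • (A * (1 - P)) with hC
  have hw : s - r ≠ 0 := sub_ne_zero.2 hs
  rw [hF, mul_add]
  set Y := -((s - r)⁻¹ • (B * J)) with hY
  have hYk : Y ^ k = 0 := by
    rw [hY, ← neg_smul, smul_pow, h.isNilpotent_mul_rieszInverse hk, smul_zero]
  have hYP : Commute Y P :=
    (((h.commute_self.symm).mul_left (h.commute_rieszInverse h.commute.symm)).smul_left _).neg_left
  -- On the range of `P` the pencil is `(s - r) A (1 - Y)` with `Y` nilpotent, so the finite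
  -- geometric sum inverts `1 - Y`.
  have h1 : (1 + (s - s₀) • A) * ((s - r)⁻¹ • ((∑ j ∈ Finset.range k, Y ^ j) * P)) = A * P := by
    have h2 : (s - r)⁻¹ • ((1 + (s - s₀) • A) * P) = A * (1 - Y) * P := by
      have h3 : A * Y = -((s - r)⁻¹ • (B * P)) := by
        rw [hY, mul_neg, mul_smul_comm, h.mul_mul_rieszInverse]
      rw [mul_sub A, mul_one, h3, sub_neg_eq_add, add_mul A, smul_mul_assoc, mul_assoc B,
        h.mul_self]
      have h4 : (1 + (s - s₀) • A) * P = B * P + (s - r) • (A * P) := by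
        rw [hB, add_mul, add_mul, smul_mul_assoc, smul_mul_assoc, sub_smul, sub_smul, sub_smul]
        module
      rw [h4, smul_add, smul_smul, inv_mul_cancel₀ hw, one_smul, add_comm]
    rw [mul_smul_comm, (Commute.sum_left _ _ _ fun j _ => hYP.pow_left j).eq, ← mul_assoc,
      ← smul_mul_assoc, h2, mul_assoc _ P,
      ← (Commute.sum_left _ _ _ fun j _ => hYP.pow_left j).eq, mul_assoc, ← mul_assoc (1 - Y),
      mul_neg_geom_sum, hYk, sub_zero, one_mul]
  have hCA : Commute (1 + (s - s₀) • A) C := by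
    have h5 : Commute A (A * (1 - P)) :=
      (Commute.refl A).mul_right ((Commute.one_right A).sub_right h.commute.symm)
    exact (Commute.one_left _).add_left
      (((Commute.one_right A).add_right (h5.smul_right _)).smul_left _)
  have h6 : (1 + (s - s₀) • A) * (Ring.inverse C * (A * (1 - P))) = A * (1 - P) := by
    have hAP : A * (1 - P) = (1 - P) * A :=
      ((Commute.one_right A).sub_right h.commute.symm).eq
    refine hu.mul_left_cancel ?_
    rw [← mul_assoc, ← hCA.eq, mul_assoc, ← mul_assoc C, Ring.mul_inverse_cancel _ hu, one_mul,
      hAP, ← mul_assoc, ← mul_assoc, h.reduced_mul]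
  rw [h1, h6]
  noncomm_ring

/-- After multiplication by `s - r` the regular part is still holomorphic on the disc, and among the
powers `(s - r) ^ (-j)` only `j = 1` has a residue; `1 < k` ensures that this term is in the sum. -/
theorem circleIntegral_eq [CompleteSpace E] (hA : IsCompactOperator A)
    (h : IsRieszProjection (1 + (r - s₀) • A) P k) (hk : 1 < k) {ρ : ℝ} (hρ : 0 < ρ)
    {F : ℂ → E →L[ℂ] E}
    (hM : ∀ s ∈ Metric.closedBall r ρ, s ≠ r → IsUnit (1 + (s - s₀) • A))
    (hF : ∀ s ∈ Metric.closedBall r ρ, s ≠ r → (1 + (s - s₀) • A) * F s = A) :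
    ((2 * Real.pi * Complex.I : ℂ)⁻¹ • ∮ s in C(r, ρ), (s - r) • F s) =
      -((1 + (r - s₀) • A) * rieszInverse A P (r - s₀) k) := by
  have hu : ∀ s ∈ Metric.closedBall r ρ, IsUnit (1 + (s - s₀) • (A * (1 - P))) := by
    intro s hs
    refine h.isUnit_reduced hA ?_
    rcases eq_or_ne s r with rfl | hsr
    · exact Or.inr rfl
    · exact Or.inl fun x => ContinuousLinearMap.eq_zero_of_isUnit (hM s hs hsr)
  set X := (1 + (r - s₀) • A) * rieszInverse A P (r - s₀) k with hX
  have hXP : X * P = X := by rw [hX, mul_assoc, h.rieszInverse_mul_proj]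
  set g : ℂ → E →L[ℂ] E := fun s =>
    (s - r) • (Ring.inverse (1 + (s - s₀) • (A * (1 - P))) * (A * (1 - P))) with hg
  set f : ℕ → ℂ → E →L[ℂ] E := fun j s => ((s - r) ^ (-(j : ℤ))) • ((-X) ^ j * P) with hf
  have hgd : ∀ s ∈ Metric.closedBall r ρ, DifferentiableAt ℂ g s := by
    intro s hs
    have h1 : DifferentiableAt ℂ (fun s : ℂ => 1 + (s - s₀) • (A * (1 - P))) s := by fun_prop
    have h2 : DifferentiableAt ℂ (fun s : ℂ => Ring.inverse (1 + (s - s₀) • (A * (1 - P)))) s :=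
      (differentiableAt_inverse (hu s hs)).fun_comp' s h1
    exact (differentiableAt_id.sub_const r).smul (h2.mul_const _)
  have hg0 : (∮ s in C(r, ρ), g s) = 0 :=
    Complex.circleIntegral_eq_zero_of_differentiable_on_off_countable hρ.le Set.countable_empty
      (fun s hs => (hgd s hs).continuousAt.continuousWithinAt)
      fun s hs => hgd s (Metric.ball_subset_closedBall hs.1)
  have hsph : ∀ s ∈ Metric.sphere r ρ, s ≠ r := fun s hs => Metric.ne_of_mem_sphere hs hρ.ne'
  have hfc : ∀ j, CircleIntegrable (f j) r ρ := fun j =>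
    ContinuousOn.circleIntegrable hρ.le (ContinuousOn.smul (ContinuousOn.zpow₀ (by fun_prop) _
      fun s hs => Or.inl (sub_ne_zero.2 (hsph s hs))) continuousOn_const)
  have hgc : CircleIntegrable g r ρ := ContinuousOn.circleIntegrable hρ.le fun s hs =>
    (hgd s (Metric.sphere_subset_closedBall hs)).continuousAt.continuousWithinAt
  have hfi : ∀ j, (∮ s in C(r, ρ), f j s) =
      if j = 1 then (2 * Real.pi * Complex.I : ℂ) • (-X) else 0 := by
    intro j
    rw [hf, circleIntegral.integral_smul_const]
    split_ifs with hj
    · subst hj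
      simp [circleIntegral.integral_sub_center_inv r hρ.ne', hXP]
    · rw [circleIntegral.integral_sub_zpow_of_ne (by omega), zero_smul]
  have hFe : Set.EqOn (fun s => (s - r) • F s) (fun s => (∑ j ∈ Finset.range k, f j s) + g s)
      (Metric.sphere r ρ) := by
    intro s hs
    have hs' := Metric.sphere_subset_closedBall hs
    have hsr := hsph s hs
    change (s - r) • F s = _
    rw [h.laurent (by omega) hsr (hM s hs' hsr) (hu s hs') (hF s hs' hsr), smul_add, smul_smul,
      mul_inv_cancel₀ (sub_ne_zero.2 hsr), one_smul, Finset.sum_mul]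
    refine congrArg₂ _ (Finset.sum_congr rfl fun j _ => ?_) rfl
    rw [hf, ← smul_neg, smul_pow, smul_mul_assoc]
    simp only [zpow_neg, zpow_natCast, inv_pow]
    rfl
  rw [circleIntegral.integral_congr hρ.le hFe, circleIntegral.integral_add
    (by simpa only [Finset.sum_fn] using CircleIntegrable.sum _ fun j _ => hfc j) hgc, hg0,
    add_zero, circleIntegral.integral_fun_sum fun j _ => hfc j]
  simp_rw [hfi]
  rw [Finset.sum_ite_eq' , if_pos (Finset.mem_range.2 hk), smul_smul, inv_mul_cancel₀
    Complex.two_pi_I_ne_zero, one_smul]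

end IsRieszProjection

end Laurent

/-! ### Reduction of the unbounded problem to compact operators -/

namespace Resonance

section Unbounded

variable {E : Type*} [NormedAddCommGroup E] [InnerProductSpace ℂ E]

theorem mem_eigenspace_iff {T : E →ₗ.[ℂ] E} {z : ℂ} {x : E} :
    x ∈ eigenspace T z ↔ ∃ h : x ∈ T.domain, subScalar T z ⟨x, h⟩ = 0 := by
  simp [eigenspace]

theorem subScalar_apply (T : E →ₗ.[ℂ] E) (z : ℂ) (x : T.domain) :
    subScalar T z x = T x - z • (x : E) := rfl

theorem subScalar_line_apply (H₀ V : E →ₗ.[ℂ] E) (z s : ℂ) {x : E} (h₀ : x ∈ H₀.domain)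
    (hv : x ∈ V.domain) (h : x ∈ (line H₀ V s).domain) :
    subScalar (line H₀ V s) z ⟨x, h⟩ = H₀ ⟨x, h₀⟩ + s • V ⟨x, hv⟩ - z • x := rfl

theorem subScalar_line_eq_add (H₀ V : E →ₗ.[ℂ] E) (z s s₀ : ℂ) {x : E} (hv : x ∈ V.domain)
    (h : x ∈ (line H₀ V s).domain) (h' : x ∈ (line H₀ V s₀).domain) :
    subScalar (line H₀ V s) z ⟨x, h⟩ =
      subScalar (line H₀ V s₀) z ⟨x, h'⟩ + (s - s₀) • V ⟨x, hv⟩ := by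
  rw [subScalar_line_apply H₀ V z s h.1 hv, subScalar_line_apply H₀ V z s₀ h.1 hv]
  module

theorem isResonancePoint_iff {H₀ V : E →ₗ.[ℂ] E} {z s : ℂ} :
    IsResonancePoint H₀ V z s ↔ ∃ x ≠ (0 : E), x ∈ eigenspace (line H₀ V s) z := by
  rw [IsResonancePoint, Submodule.ne_bot_iff]
  exact ⟨fun ⟨x, h, h'⟩ => ⟨x, h', h⟩, fun ⟨x, h, h'⟩ => ⟨x, h', h⟩⟩

theorem IsInverseAt.resolvent_eq {T : E →ₗ.[ℂ] E} {z : ℂ} {R : E →L[ℂ] E}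
    (h : IsInverseAt T z R) : resolvent T z = R := by
  have hex : ∃ R : E →L[ℂ] E, IsInverseAt T z R := ⟨R, h⟩
  rw [resolvent, dif_pos hex]
  ext y
  obtain ⟨x, hx, hxy⟩ := h.2 y
  rw [← hx, ← hxy, hex.choose_spec.1 x]

theorem isInverseAt_resolvent {T : E →ₗ.[ℂ] E} {z : ℂ} (hz : z ∈ resolventSet T) :
    IsInverseAt T z (resolvent T z) := by
  obtain ⟨R, hR⟩ := hz
  rwa [hR.resolvent_eq]

theorem ExtendsProduct.boundedProduct_eq {R K : E →L[ℂ] E} {V : E →ₗ.[ℂ] E}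
    (hV : Dense (V.domain : Set E)) (h : ExtendsProduct R V K) : boundedProduct R V = K := by
  have hex : ∃ K : E →L[ℂ] E, ExtendsProduct R V K := ⟨K, h⟩
  rw [boundedProduct, dif_pos hex]
  exact ContinuousLinearMap.ext_on (s := (V.domain : Set E))
    (hV.mono Submodule.subset_span) fun x hx =>
    (hex.choose_spec ⟨x, hx⟩).trans (h ⟨x, hx⟩).symm

variable [CompleteSpace E]

theorem inner_symm_of_isSelfAdjoint {T : E →ₗ.[ℂ] E} (hT : IsSelfAdjoint T) (x y : T.domain) :
    ⟪T x, (y : E)⟫_ℂ = ⟪(x : E), T y⟫_ℂ := by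
  have h := LinearPMap.adjoint_isFormalAdjoint hT.dense_domain
  rw [LinearPMap.isSelfAdjoint_def.1 hT] at h
  exact h x y

theorem mem_domain_of_isSelfAdjoint {T : E →ₗ.[ℂ] E} (hT : IsSelfAdjoint T) {y w : E}
    (h : ∀ x : T.domain, ⟪w, (x : E)⟫_ℂ = ⟪y, T x⟫_ℂ) : ∃ hy : y ∈ T.domain, T ⟨y, hy⟩ = w := by
  have h1 := LinearPMap.mem_adjoint_domain_of_exists (T := T) y ⟨w, h⟩
  have h2 := LinearPMap.adjoint_apply_eq hT.dense_domain ⟨y, h1⟩ h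
  have key : ∀ T' : E →ₗ.[ℂ] E, T' = T → ∀ h1 : y ∈ T'.domain, T' ⟨y, h1⟩ = w →
      ∃ hy : y ∈ T.domain, T ⟨y, hy⟩ = w := by
    rintro _ rfl h1 h2
    exact ⟨h1, h2⟩
  exact key _ (LinearPMap.isSelfAdjoint_def.1 hT) h1 h2

/-- A bijective symmetric operator has a bounded symmetric inverse. -/
theorem exists_inverse_of_symmetric {D : Submodule ℂ E} (f : D →ₗ[ℂ] E)
    (hsymm : ∀ x y : D, ⟪f x, (y : E)⟫_ℂ = ⟪(x : E), f y⟫_ℂ) (hf : Function.Bijective f) :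
    ∃ G : E →L[ℂ] E, (∀ x : D, G (f x) = x) ∧ (∀ y : E, ∃ x : D, (x : E) = G y ∧ f x = y) ∧
      ∀ x y : E, ⟪G x, y⟫_ℂ = ⟪x, G y⟫_ℂ := by
  let e := LinearEquiv.ofBijective f hf
  let g : E →ₗ[ℂ] E := D.subtype ∘ₗ (e.symm : E →ₗ[ℂ] D)
  have hfe : ∀ y, f (e.symm y) = y := fun y => e.apply_symm_apply y
  have hg : g.IsSymmetric := fun x y => by
    change ⟪((e.symm x : D) : E), y⟫_ℂ = ⟪x, ((e.symm y : D) : E)⟫_ℂ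
    conv_lhs => rw [← hfe y]
    rw [← hsymm, hfe]
  -- Hellinger–Toeplitz: an everywhere defined symmetric operator is bounded.
  refine ⟨⟨g, hg.continuous⟩, fun x => ?_, fun y => ⟨e.symm y, rfl, hfe y⟩, hg⟩
  change ((e.symm (e x) : D) : E) = x
  rw [e.symm_apply_apply]

/-- The relatively compact operator `V` factors through `H₀ - z̄` by a compact operator. -/
theorem exists_compact_factor {H₀ V : E →ₗ.[ℂ] E} (hH₀ : IsSelfAdjoint H₀) (hV : IsSelfAdjoint V)
    (hrel : IsRelativelyCompact H₀ V) :
    ∃ (Q : E →L[ℂ] E) (w : ℂ), IsCompactOperator Q ∧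
      ∀ (x : E) (h₀ : x ∈ H₀.domain) (hv : x ∈ V.domain),
        V ⟨x, hv⟩ = Q (H₀ ⟨x, h₀⟩ - w • x) := by
  obtain ⟨-, z, hz, K, hK, hKc⟩ := hrel
  have hR := isInverseAt_resolvent hz
  set R := resolvent H₀ z with hRdef
  -- The factor is `K*`: self-adjointness of `V` gives `V R* = (R V)* = K*`, and `R*` inverts `H₀ -
  -- z̄`.
  refine ⟨ContinuousLinearMap.adjoint K, starRingEnd ℂ z, hKc.adjoint, fun x h₀ hv => ?_⟩
  have h1 : ContinuousLinearMap.adjoint R (H₀ ⟨x, h₀⟩ - starRingEnd ℂ z • x) = x := by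
    refine ext_inner_right ℂ fun y => ?_
    obtain ⟨u, hu, huy⟩ := hR.2 y
    rw [ContinuousLinearMap.adjoint_inner_left, ← hu, inner_sub_left,
      inner_symm_of_isSelfAdjoint hH₀ ⟨x, h₀⟩ u, inner_smul_left, Complex.conj_conj, ← huy,
      subScalar_apply, inner_sub_right, inner_smul_right]
  obtain ⟨h2, h3⟩ := mem_domain_of_isSelfAdjoint hV
    (y := ContinuousLinearMap.adjoint R (H₀ ⟨x, h₀⟩ - starRingEnd ℂ z • x))
    (w := ContinuousLinearMap.adjoint K (H₀ ⟨x, h₀⟩ - starRingEnd ℂ z • x)) fun u => by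
      rw [ContinuousLinearMap.adjoint_inner_left, ContinuousLinearMap.adjoint_inner_left, hK u]
  rw [← h3]
  congr 2
  exact h1.symm

omit [CompleteSpace E] in
theorem subScalar_symm {T : E →ₗ.[ℂ] E}
    (hT : ∀ x y : T.domain, ⟪T x, (y : E)⟫_ℂ = ⟪(x : E), T y⟫_ℂ)
    (lam : ℝ) (x y : T.domain) :
    ⟪subScalar T lam x, (y : E)⟫_ℂ = ⟪(x : E), subScalar T lam y⟫_ℂ := by
  rw [subScalar_apply, subScalar_apply, inner_sub_left, inner_sub_right, hT, inner_smul_left,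
    inner_smul_right, Complex.conj_ofReal]

theorem line_symm {H₀ V : E →ₗ.[ℂ] E} (hH₀ : IsSelfAdjoint H₀) (hV : IsSelfAdjoint V) (s : ℝ)
    (x y : (line H₀ V s).domain) :
    ⟪line H₀ V s x, (y : E)⟫_ℂ = ⟪(x : E), line H₀ V s y⟫_ℂ := by
  change ⟪H₀ ⟨x, x.2.1⟩ + (s : ℂ) • V ⟨x, x.2.2⟩, (y : E)⟫_ℂ =
    ⟪(x : E), H₀ ⟨y, y.2.1⟩ + (s : ℂ) • V ⟨y, y.2.2⟩⟫_ℂ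
  rw [inner_add_left, inner_add_right, inner_smul_left, inner_smul_right, Complex.conj_ofReal]
  have h1 := inner_symm_of_isSelfAdjoint hH₀ ⟨x, x.2.1⟩ ⟨y, y.2.1⟩
  have h2 := inner_symm_of_isSelfAdjoint hV ⟨x, x.2.2⟩ ⟨y, y.2.2⟩
  simp only at h1 h2
  rw [h1, h2]

/-- If `lam` is outside the essential spectrum of `H₀` then `H₀ - lam + P` is invertible, where `P`
is the projection onto the eigenspace. -/
theorem exists_inverse_add_proj {H₀ : E →ₗ.[ℂ] E} (hH₀ : IsSelfAdjoint H₀) (lam : ℝ)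
    (hlam : (lam : ℂ) ∉ essentialSpectrum H₀) :
    ∃ P G : E →L[ℂ] E, IsCompactOperator P ∧
      ∀ y : E, ∃ x : H₀.domain, (x : E) = G y ∧ subScalar H₀ lam x + P x = y := by
  obtain ⟨hfd, hcl, -⟩ := not_not.1 hlam
  set N := eigenspace H₀ lam with hN
  have hfdN : FiniteDimensional ℂ N := by rw [hN, eigenspace]; infer_instance
  set P := N.starProjection with hP
  have hPc : IsCompactOperator P := by
    have : LocallyCompactSpace N := @locallyCompact_of_proper _ _ (FiniteDimensional.proper ℂ N)
    exact (isCompactOperator_id.comp_clm N.orthogonalProjectionOnto).clm_comp N.subtypeL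
  have hsymm := subScalar_symm (inner_symm_of_isSelfAdjoint hH₀) lam
  have hPN : ∀ x, ∃ h : P x ∈ H₀.domain, subScalar H₀ lam ⟨P x, h⟩ = 0 := fun x =>
    mem_eigenspace_iff.1 (N.starProjection_apply_mem x)
  have hPid : ∀ x ∈ N, P x = x := fun x hx => Submodule.starProjection_eq_self_iff.2 hx
  have hPf : ∀ x, P (subScalar H₀ lam x) = 0 := fun x => by
    rw [hP, Submodule.starProjection_apply_eq_zero_iff, Submodule.mem_orthogonal]
    intro u hu
    obtain ⟨h, h'⟩ := mem_eigenspace_iff.1 hu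
    have := hsymm ⟨u, h⟩ x
    rw [h', inner_zero_left] at this
    exact this.symm
  let f : H₀.domain →ₗ[ℂ] E := subScalar H₀ lam + (P : E →ₗ[ℂ] E) ∘ₗ H₀.domain.subtype
  have hf : ∀ x, f x = subScalar H₀ lam x + P x := fun x => rfl
  have hinj : Function.Injective f := by
    rw [← LinearMap.ker_eq_bot, LinearMap.ker_eq_bot']
    intro x hx
    rw [hf] at hx
    have h1 : P (x : E) = 0 := by
      have := congrArg P hx
      rw [map_add, hPf, zero_add, map_zero, hPid _ (N.starProjection_apply_mem _)] at this
      exact this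
    rw [h1, add_zero] at hx
    have := hPid x (mem_eigenspace_iff.2 ⟨x.2, hx⟩)
    exact Subtype.ext (by rw [← this, h1]; rfl)
  have hsurj : Function.Surjective f := by
    intro y
    -- The range is closed, and its orthogonal complement is the eigenspace because `H₀` is
    -- self-adjoint.
    have hrange : y - P y ∈ LinearMap.range (subScalar H₀ (lam : ℂ)) := by
      have : CompleteSpace (LinearMap.range (subScalar H₀ (lam : ℂ))) := hcl.completeSpace_coe
      rw [← (LinearMap.range (subScalar H₀ (lam : ℂ))).orthogonal_orthogonal,
        Submodule.mem_orthogonal]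
      intro u hu
      have huN : u ∈ N := by
        obtain ⟨h1, h2⟩ := mem_domain_of_isSelfAdjoint hH₀ (y := u) (w := (lam : ℂ) • u)
          fun x => by
            have := Submodule.inner_left_of_mem_orthogonal (LinearMap.mem_range_self _ x) hu
            rw [subScalar_apply, inner_sub_right, inner_smul_right, sub_eq_zero] at this
            rw [inner_smul_left, Complex.conj_ofReal, this]
        exact mem_eigenspace_iff.2 ⟨h1, by rw [subScalar_apply, h2, sub_self]⟩
      exact Submodule.inner_right_of_mem_orthogonal huN (N.sub_starProjection_mem_orthogonal y)
    obtain ⟨x, hx⟩ := hrange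
    obtain ⟨h1, h2⟩ := hPN (x : E)
    obtain ⟨h3, h4⟩ := hPN y
    refine ⟨x - ⟨_, h1⟩ + ⟨_, h3⟩, ?_⟩
    rw [hf, map_add, map_sub, hx, h2, h4]
    simp only [Submodule.coe_add, Submodule.coe_sub, map_add, map_sub]
    rw [hPid _ (N.starProjection_apply_mem (x : E)), hPid _ (N.starProjection_apply_mem y)]
    abel
  have hfsymm : ∀ x y : H₀.domain, ⟪f x, (y : E)⟫_ℂ = ⟪(x : E), f y⟫_ℂ := fun x y => by
    rw [hf, hf, inner_add_left, inner_add_right, hsymm]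
    congr 1
    exact N.inner_starProjection_left_eq_right _ _
  obtain ⟨G, -, hG, -⟩ := exists_inverse_of_symmetric f hfsymm ⟨hinj, hsurj⟩
  exact ⟨P, G, hPc, hG⟩

/-- `G` is the resolvent of `H_s` at `lam`, where `s` is a real number which is not a resonance
point, `T = V G`, and `A` is the bounded extension of `G V`. -/
structure IsBasePoint (H₀ V : E →ₗ.[ℂ] E) (lam s₀ : ℝ) (G T A : E →L[ℂ] E) : Prop where
  inverse : IsInverseAt (line H₀ V s₀) lam G
  apply_inverse : ∀ (y : E) (h : G y ∈ V.domain), V ⟨G y, h⟩ = T y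
  extends_product : ExtendsProduct G V A
  compact_right : IsCompactOperator T
  compact_left : IsCompactOperator A
  adjoint_eq : ContinuousLinearMap.adjoint T = A
  symm : ∀ x y : E, ⟪G x, y⟫_ℂ = ⟪x, G y⟫_ℂ

/-- With `G₀ = (H₀ - λ + P)⁻¹` and `T₀ = V G₀` compact, `(H_{s₀} - λ) G₀ = 1 + s₀ T₀ - P G₀`. This
is injective as `s₀` is not resonant, hence invertible by the Fredholm alternative, so `H_{s₀} - λ`
is onto. -/
theorem exists_isBasePoint {H₀ V : E →ₗ.[ℂ] E} (hH₀ : IsSelfAdjoint H₀) (hV : IsSelfAdjoint V)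
    (hrel : IsRelativelyCompact H₀ V) (lam : ℝ) (hlam : (lam : ℂ) ∉ essentialSpectrum H₀)
    (s₀ : ℝ) (hs₀ : ¬ IsResonancePoint H₀ V lam s₀) :
    ∃ G T A : E →L[ℂ] E, IsBasePoint H₀ V lam s₀ G T A := by
  obtain ⟨P, G₀, hPc, hG₀⟩ := exists_inverse_add_proj hH₀ lam hlam
  obtain ⟨Q, w, hQc, hQ⟩ := exists_compact_factor hH₀ hV hrel
  -- For `x = G₀ y`, `(H₀ - w) x = y - P x + (λ - w) x`; the compact factor `Q` sends this to `V x`.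
  set T₀ : E →L[ℂ] E := Q * (1 + ((lam : ℂ) - w) • G₀ - P * G₀) with hT₀
  have hT₀c : IsCompactOperator T₀ := hQc.comp_clm (1 + ((lam : ℂ) - w) • G₀ - P * G₀)
  have hG₀' : ∀ y, ∃ x : (line H₀ V s₀).domain, (x : E) = G₀ y ∧ V ⟨x, x.2.2⟩ = T₀ y ∧
      subScalar (line H₀ V s₀) lam x = (1 + ((s₀ : ℂ) • T₀ - P * G₀)) y := by
    intro y
    obtain ⟨x, hx, hxy⟩ := hG₀ y
    have hv : (x : E) ∈ V.domain := hrel.1 x.2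
    have hVx : V ⟨x, hv⟩ = T₀ y := by
      rw [hQ x x.2 hv, hT₀, mul_apply_eq_comp]
      congr 1
      change _ = y + ((lam : ℂ) - w) • G₀ y - P (G₀ y)
      rw [subScalar_apply] at hxy
      rw [← hx, ← hxy]
      module
    have hmem : (x : E) ∈ (line H₀ V s₀).domain := ⟨x.2, hv⟩
    refine ⟨⟨x, hmem⟩, hx, hVx, ?_⟩
    rw [subScalar_line_apply H₀ V lam s₀ x.2 hv hmem, hVx]
    change _ = y + ((s₀ : ℂ) • T₀ y - P (G₀ y))
    rw [subScalar_apply] at hxy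
    rw [← hx]
    conv_rhs => enter [1]; rw [← hxy]
    module
  have hinj : ∀ x : (line H₀ V s₀).domain, subScalar (line H₀ V s₀) lam x = 0 → x = 0 := by
    intro x hx
    by_contra hne
    exact hs₀ (isResonancePoint_iff.2 ⟨x, fun h => hne (Subtype.ext h),
      mem_eigenspace_iff.2 ⟨x.2, hx⟩⟩)
  have hU : IsUnit (1 + ((s₀ : ℂ) • T₀ - P * G₀)) := by
    refine IsCompactOperator.isUnit_one_add (K := (s₀ : ℂ) • T₀ - P * G₀) ?_ fun y hy => ?_
    · exact IsCompactOperator.sub (f := ((s₀ : ℂ) • T₀ : E →L[ℂ] E)) (g := (P * G₀ : E →L[ℂ] E))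
        (IsCompactOperator.smul (f := T₀) hT₀c (s₀ : ℂ)) (hPc.comp_clm G₀)
    · obtain ⟨x, hx, -, hxy⟩ := hG₀' y
      rw [hy] at hxy
      have h0 := hinj x hxy
      obtain ⟨x', hx', hx'y⟩ := hG₀ y
      have : x' = 0 := Subtype.ext (by rw [hx', ← hx, h0]; rfl)
      rw [← hx'y, this]
      simp
  obtain ⟨u, hu⟩ := hU
  set W : E →L[ℂ] E := ↑u⁻¹ with hW
  have hNW : ∀ y, (1 + ((s₀ : ℂ) • T₀ - P * G₀)) (W y) = y := fun y => by
    rw [← hu, hW]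
    exact congrArg (fun S : E →L[ℂ] E => S y) u.mul_inv
  have hinj' : Function.Injective (subScalar (line H₀ V s₀) (lam : ℂ)) := by
    rw [← LinearMap.ker_eq_bot, LinearMap.ker_eq_bot']
    exact hinj
  obtain ⟨G, hG1, hG2, hG3⟩ := exists_inverse_of_symmetric (subScalar (line H₀ V s₀) (lam : ℂ))
    (subScalar_symm (line_symm hH₀ hV s₀) lam) ⟨hinj', fun y => by
      obtain ⟨x, -, -, hx⟩ := hG₀' (W y)
      exact ⟨x, by rw [hx, hNW]⟩⟩
  have hVG : ∀ (y : E) (h : G y ∈ V.domain), V ⟨G y, h⟩ = (T₀ * W) y := by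
    intro y h
    obtain ⟨x, hx, hVx, hxy⟩ := hG₀' (W y)
    rw [hNW] at hxy
    have h1 : G y = x := by rw [← hxy, hG1]
    rw [mul_apply_eq_comp, ← hVx]
    congr 1
    exact Subtype.ext h1
  have hTc : IsCompactOperator (T₀ * W : E →L[ℂ] E) := hT₀c.comp_clm W
  refine ⟨G, T₀ * W, ContinuousLinearMap.adjoint (T₀ * W), ⟨hG1, hG2⟩, hVG, fun x => ?_, hTc,
    hTc.adjoint, rfl, hG3⟩
  refine ext_inner_right ℂ fun y => ?_
  obtain ⟨u, hu, -⟩ := hG2 y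
  have hv : G y ∈ V.domain := by rw [← hu]; exact u.2.2
  rw [ContinuousLinearMap.adjoint_inner_left, hG3, ← hVG y hv]
  exact (inner_symm_of_isSelfAdjoint hV x ⟨G y, hv⟩).symm

end Unbounded

end Resonance

/-! ### The pencil at a base point -/

namespace Resonance

section Line

variable {E : Type*} [NormedAddCommGroup E] [InnerProductSpace ℂ E]

/-- Generalized eigenvectors of `A` lie in the range of `G` if `A G = G T` and `G` has dense
range. -/
theorem mem_range_of_pow_eq_zero [CompleteSpace E] {A T G : E →L[ℂ] E} (hA : IsCompactOperator A)
    (hT : IsCompactOperator T) (hGd : Dense (Set.range G)) (hAG : ∀ x, A (G x) = G (T x))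
    (c : ℂ) {j : ℕ} {χ : E} (hχ : ((1 + c • A) ^ j) χ = 0) : ∃ y, G y = χ := by
  have hAc : IsCompactOperator (c • A : E →L[ℂ] E) := IsCompactOperator.smul (f := A) hA c
  have hTc : IsCompactOperator (c • T : E →L[ℂ] E) := IsCompactOperator.smul (f := T) hT c
  obtain ⟨kA, -, hkA⟩ := hAc.exists_isRieszProjection
  obtain ⟨kT, -, hkT⟩ := hTc.exists_isRieszProjection
  obtain ⟨P, hP⟩ := hkA (max kA kT) (le_max_left _ _)
  obtain ⟨P', hP'⟩ := hkT (max kA kT) (le_max_right _ _)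
  set k := max kA kT
  have hpow : ∀ (n : ℕ) (x : E), ((1 + c • A) ^ n : E →L[ℂ] E) (G x) =
      G (((1 + c • T) ^ n : E →L[ℂ] E) x) := by
    intro n
    induction n with
    | zero => intro x; rfl
    | succ n ih =>
      intro x
      rw [pow_succ, pow_succ, mul_apply_eq_comp, mul_apply_eq_comp, ← ih]
      congr 1
      change G x + c • A (G x) = G (x + c • T x)
      rw [hAG, map_add, map_smul]
  let S : Submodule ℂ E := LinearMap.range (G : E →ₗ[ℂ] E) ⊓
    LinearMap.ker (((1 + c • A) ^ k : E →L[ℂ] E) : E →ₗ[ℂ] E)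
  have hSfd : FiniteDimensional ℂ S := by
    obtain ⟨K', hK', hK'e⟩ := hAc.exists_one_add_pow k
    have := hK'.finiteDimensional_ker_one_add
    rw [← hK'e] at this
    exact Submodule.finiteDimensional_inf_right _ _
  -- Intertwining carries the Riesz decomposition for `T` to the one for `A`, so `P G = G P'`. Hence
  -- `P` maps the dense range of `G` into the finite-dimensional, so closed, space `S`, and by
  -- continuity `χ = P χ` lies there too.
  have hmaps : Set.MapsTo P (Set.range G) (S : Set E) := by
    rintro _ ⟨x, rfl⟩
    obtain ⟨z, hz⟩ := hP'.exists_eq x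
    have h0 : ((1 + c • A) ^ k) (G (P' x)) = 0 := by
      rw [hpow, show ((1 + c • T) ^ k) (P' x) = 0 from
        congrArg (fun S : E →L[ℂ] E => S x) hP'.pow_mul, map_zero]
    have h1 : P (G x) = G (P' x) := by
      conv_lhs => rw [hz]
      rw [map_add, map_add, ← hpow, hP.apply_of_ker k _ h0,
        show P (((1 + c • A) ^ k) (G z)) = 0 from
          congrArg (fun S : E →L[ℂ] E => S (G z)) hP.mul_pow, add_zero]
    rw [h1]
    exact ⟨⟨_, rfl⟩, h0⟩
  have h2 := map_mem_closure P.continuous (hGd χ) hmaps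
  rw [S.closed_of_finiteDimensional.closure_eq, hP.apply_of_ker j χ hχ] at h2
  exact h2.1

/-- The range contains the kernel of the Riesz projection, a closed subspace of finite codimension.
-/
theorem isClosed_range_one_add [CompleteSpace E] {K : E →L[ℂ] E} (hK : IsCompactOperator K) :
    IsClosed (LinearMap.range ((1 + K : E →L[ℂ] E) : E →ₗ[ℂ] E) : Set E) := by
  obtain ⟨k, hk, hP⟩ := hK.exists_isRieszProjection
  obtain ⟨P, hP⟩ := hP k le_rfl
  obtain ⟨K', hK', hK'e⟩ := hK.exists_one_add_pow k
  have hfd := hK'.finiteDimensional_ker_one_add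
  rw [← hK'e] at hfd
  have hle : LinearMap.range (P : E →ₗ[ℂ] E) ≤
      LinearMap.ker (((1 + K) ^ k : E →L[ℂ] E) : E →ₗ[ℂ] E) := by
    rintro _ ⟨x, rfl⟩
    exact congrArg (fun S : E →L[ℂ] E => S x) hP.pow_mul
  have hfdr : FiniteDimensional ℂ (LinearMap.range (P : E →ₗ[ℂ] E)) :=
    Submodule.finiteDimensional_of_le hle
  have hq : FiniteDimensional ℂ (E ⧸ LinearMap.ker (P : E →ₗ[ℂ] E)) :=
    (LinearMap.quotKerEquivRange (P : E →ₗ[ℂ] E)).symm.finiteDimensional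
  refine Submodule.isClosed_mono_of_finiteDimensional_quotient
    (ContinuousLinearMap.isClosed_ker P) ?_
  intro y hy
  obtain ⟨x, hx⟩ := hP.exists_eq y
  obtain ⟨n, rfl⟩ : ∃ n, k = n + 1 := ⟨k - 1, by omega⟩
  refine ⟨((1 + K) ^ n) x, ?_⟩
  rw [show P y = 0 from hy, zero_add, pow_succ'] at hx
  exact hx.symm

namespace IsBasePoint

variable [CompleteSpace E] {H₀ V : E →ₗ.[ℂ] E} {lam s₀ : ℝ} {G T A : E →L[ℂ] E}

theorem exists_eq (hb : IsBasePoint H₀ V lam s₀ G T A) (s : ℂ) (y : E) :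
    ∃ x : (line H₀ V s).domain, (x : E) = G y ∧
      subScalar (line H₀ V s) lam x = (1 + (s - s₀) • T) y := by
  obtain ⟨x, hx, hxy⟩ := hb.inverse.2 y
  have hm : (x : E) ∈ (line H₀ V s).domain := x.2
  have hv : G y ∈ V.domain := by rw [← hx]; exact x.2.2
  refine ⟨⟨x, hm⟩, hx, ?_⟩
  rw [subScalar_line_eq_add H₀ V lam s s₀ hm.2 hm x.2]
  change subScalar (line H₀ V s₀) lam x + _ = y + (s - s₀) • T y
  rw [hxy, ← hb.apply_inverse y hv]
  congr 3
  exact Subtype.ext hx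

theorem inverse_apply (hb : IsBasePoint H₀ V lam s₀ G T A) (s : ℂ) (x : (line H₀ V s).domain) :
    G (subScalar (line H₀ V s) lam x) = (1 + (s - s₀) • A) x := by
  have hm : (x : E) ∈ (line H₀ V s₀).domain := x.2
  have := subScalar_line_eq_add H₀ V lam s s₀ x.2.2 x.2 hm
  rw [Subtype.coe_eta] at this
  rw [this, map_add, map_smul, hb.inverse.1 ⟨x, hm⟩, ← hb.extends_product]
  rfl

theorem injective (hb : IsBasePoint H₀ V lam s₀ G T A) {y : E} (hy : G y = 0) : y = 0 := by
  obtain ⟨x, hx, hxy⟩ := hb.inverse.2 y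
  have : x = 0 := Subtype.ext (hx.trans hy)
  rw [← hxy, this, map_zero]

theorem intertwine (hb : IsBasePoint H₀ V lam s₀ G T A) (y : E) : A (G y) = G (T y) := by
  obtain ⟨x, hx, -⟩ := hb.inverse.2 y
  have hv : G y ∈ V.domain := by rw [← hx]; exact x.2.2
  rw [← hb.apply_inverse y hv]
  exact hb.extends_product ⟨G y, hv⟩

theorem dense_range (hb : IsBasePoint H₀ V lam s₀ G T A) : Dense (Set.range G) := by
  have h : (LinearMap.range (G : E →ₗ[ℂ] E))ᗮ = ⊥ := by
    rw [Submodule.eq_bot_iff]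
    intro u hu
    refine hb.injective (ext_inner_right ℂ fun y => ?_)
    rw [hb.symm, inner_zero_left]
    exact Submodule.inner_left_of_mem_orthogonal (LinearMap.mem_range_self _ y) hu
  have := Submodule.dense_iff_topologicalClosure_eq_top.2
    ((Submodule.topologicalClosure_eq_top_iff).2 h)
  exact this

theorem exists_mem_domain (hb : IsBasePoint H₀ V lam s₀ G T A) {c : ℂ} {j : ℕ} {χ : E}
    (hχ : ((1 + c • A) ^ j) χ = 0) (s : ℂ) : χ ∈ (line H₀ V s).domain := by
  obtain ⟨y, rfl⟩ := mem_range_of_pow_eq_zero hb.compact_left hb.compact_right hb.dense_range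
    hb.intertwine c hχ
  obtain ⟨x, hx, -⟩ := hb.exists_eq s y
  rw [← hx]
  exact x.2

theorem mem_eigenspace_iff (hb : IsBasePoint H₀ V lam s₀ G T A) {s : ℂ} {x : E} :
    x ∈ eigenspace (line H₀ V s) lam ↔ (1 + (s - s₀) • A) x = 0 := by
  rw [Resonance.mem_eigenspace_iff]
  constructor
  · rintro ⟨h, h'⟩
    have := hb.inverse_apply s ⟨x, h⟩
    rw [h', map_zero] at this
    exact this.symm
  · intro hx
    have hm := hb.exists_mem_domain (j := 1) (by rwa [pow_one]) s
    refine ⟨hm, hb.injective ?_⟩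
    rw [hb.inverse_apply s ⟨x, hm⟩, hx]

theorem not_isResonancePoint_iff (hb : IsBasePoint H₀ V lam s₀ G T A) {s : ℂ} :
    ¬ IsResonancePoint H₀ V lam s ↔ ∀ x, (1 + (s - s₀) • A) x = 0 → x = 0 := by
  rw [isResonancePoint_iff]
  push Not
  refine forall_congr' fun x => ?_
  rw [hb.mem_eigenspace_iff]
  tauto

theorem isUnit_left (hb : IsBasePoint H₀ V lam s₀ G T A) {s : ℂ}
    (hs : ¬ IsResonancePoint H₀ V lam s) : IsUnit (1 + (s - s₀) • A) :=
  IsCompactOperator.isUnit_one_add (K := (s - s₀) • A)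
    (IsCompactOperator.smul (f := A) hb.compact_left _) (hb.not_isResonancePoint_iff.1 hs)

theorem isUnit_right (hb : IsBasePoint H₀ V lam s₀ G T A) {s : ℂ}
    (hs : ¬ IsResonancePoint H₀ V lam s) : IsUnit (1 + (s - s₀) • T) := by
  refine IsCompactOperator.isUnit_one_add (K := (s - s₀) • T)
    (IsCompactOperator.smul (f := T) hb.compact_right _) fun y hy => hb.injective ?_
  refine hb.not_isResonancePoint_iff.1 hs _ ?_
  have h1 : (1 + (s - s₀) • A) (G y) = G ((1 + (s - s₀) • T) y) := by
    change G y + (s - s₀) • A (G y) = G (y + (s - s₀) • T y)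
    rw [hb.intertwine, map_add, map_smul]
  rw [h1]
  exact (congrArg G hy).trans (map_zero G)

/-- The resolvent at `s` is `G (1 + (s - s₀) T)⁻¹ = (1 + (s - s₀) A)⁻¹ G`; the second form gives the
bounded extension of its product with `V`. -/
theorem mul_opA (hb : IsBasePoint H₀ V lam s₀ G T A) (hV : IsSelfAdjoint V) {s : ℂ}
    (hs : ¬ IsResonancePoint H₀ V lam s) : (1 + (s - s₀) • A) * opA H₀ V lam s = A := by
  obtain ⟨u, hu⟩ := hb.isUnit_right hs
  obtain ⟨v, hv⟩ := hb.isUnit_left hs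
  have hNW : ∀ y, (1 + (s - s₀) • T) ((↑u⁻¹ : E →L[ℂ] E) y) = y := fun y => by
    rw [← hu]
    exact congrArg (fun S : E →L[ℂ] E => S y) u.mul_inv
  have hR2 : ∀ y, ∃ x : (line H₀ V s).domain, (x : E) = (G * (↑u⁻¹ : E →L[ℂ] E)) y ∧
      subScalar (line H₀ V s) lam x = y := fun y => by
    obtain ⟨x, hx, hxy⟩ := hb.exists_eq s ((↑u⁻¹ : E →L[ℂ] E) y)
    exact ⟨x, hx, by rw [hxy, hNW]⟩
  have hR : IsInverseAt (line H₀ V s) lam (G * (↑u⁻¹ : E →L[ℂ] E)) := by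
    refine ⟨fun x => ?_, hR2⟩
    obtain ⟨x', hx', hx'y⟩ := hR2 (subScalar (line H₀ V s) lam x)
    rw [← hx']
    have h1 : (x' - x : E) ∈ eigenspace (line H₀ V s) lam :=
      Resonance.mem_eigenspace_iff.2 ⟨(x' - x).2, (map_sub _ x' x).trans (sub_eq_zero.2 hx'y)⟩
    exact sub_eq_zero.1 (hb.not_isResonancePoint_iff.1 hs _ (hb.mem_eigenspace_iff.1 h1))
  have hMR : (1 + (s - s₀) • A) * (G * (↑u⁻¹ : E →L[ℂ] E)) = G := by
    ext y
    obtain ⟨x, hx, hxy⟩ := hR2 y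
    rw [mul_apply_eq_comp, ← hx, ← hb.inverse_apply, hxy]
  have hK : ExtendsProduct (G * (↑u⁻¹ : E →L[ℂ] E)) V ((↑v⁻¹ : E →L[ℂ] E) * A) := by
    intro x
    rw [mul_apply_eq_comp, hb.extends_product x]
    have h2 : G * (↑u⁻¹ : E →L[ℂ] E) = (↑v⁻¹ : E →L[ℂ] E) * G := by
      rw [Units.eq_inv_mul_iff_mul_eq, hv, hMR]
    rw [h2, mul_apply_eq_comp]
  rw [opA, hR.resolvent_eq, hK.boundedProduct_eq hV.dense_domain, ← hv, ← mul_assoc,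
    Units.mul_inv, one_mul]

theorem not_isResonancePoint_self (hb : IsBasePoint H₀ V lam s₀ G T A) :
    ¬ IsResonancePoint H₀ V lam s₀ :=
  hb.not_isResonancePoint_iff.2 fun x hx => by simpa using hx

theorem isResonanceVector_iff (hb : IsBasePoint H₀ V lam s₀ G T A) (hV : IsSelfAdjoint V) {r : ℂ}
    {χ : E} : IsResonanceVector H₀ V lam r χ ↔ ∃ j : ℕ, ((1 + (r - s₀) • A) ^ j : E →L[ℂ] E) χ = 0 := by
  constructor
  · rintro ⟨s, hs, k, -, hk⟩
    refine ⟨k, ?_⟩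
    have hM := hb.mul_opA hV hs
    have hu := hb.isUnit_left hs
    have hcomm : Commute (1 + (s - s₀) • A) (opA H₀ V lam s) := by
      refine (hu.mul_left_cancel ?_ : _ = _)
      rw [hM, ← mul_assoc, hM, (commute_one_add_smul_self A _).eq]
    -- The resolvent identity moves the reference point from `s` to `s₀`; the factors commute, so
    -- powers factor as well.
    have hB : 1 + (r - s₀) • A = (1 + (s - s₀) • A) * (1 + (r - s) • opA H₀ V lam s) := by
      rw [mul_add, mul_one, mul_smul_comm, hM]
      module
    rw [hB, Commute.mul_pow ((Commute.one_right _).add_right (hcomm.smul_right _)),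
      mul_apply_eq_comp, hk, map_zero]
  · rintro ⟨j, hj⟩
    refine ⟨s₀, hb.not_isResonancePoint_self, j + 1, by omega, ?_⟩
    have hM := hb.mul_opA hV hb.not_isResonancePoint_self
    rw [sub_self, zero_smul, add_zero, one_mul] at hM
    rw [hM, pow_succ', mul_apply_eq_comp, hj, map_zero]

/-- The range of `H_r - λ` contains that of `1 + (r - s₀) T`, which is closed; its orthogonal
complement is the kernel of the adjoint `1 + (r - s₀) A`, that is, the eigenspace. -/
theorem exists_of_mem_orthogonal (hb : IsBasePoint H₀ V lam s₀ G T A) (r : ℝ) {w : E}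
    (hw : w ∈ (eigenspace (line H₀ V r) lam)ᗮ) :
    ∃ x : (line H₀ V r).domain, subScalar (line H₀ V r) lam x = w := by
  have hTc : IsCompactOperator (((r : ℂ) - s₀) • T : E →L[ℂ] E) :=
    IsCompactOperator.smul (f := T) hb.compact_right _
  set W := LinearMap.range ((1 + ((r : ℂ) - s₀) • T : E →L[ℂ] E) : E →ₗ[ℂ] E) with hW
  have hcl : IsClosed (W : Set E) := isClosed_range_one_add hTc
  have hadj : ContinuousLinearMap.adjoint (1 + ((r : ℂ) - s₀) • T) = 1 + ((r : ℂ) - s₀) • A := by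
    rw [← ContinuousLinearMap.star_eq_adjoint, star_add, star_one, star_smul,
      ContinuousLinearMap.star_eq_adjoint, hb.adjoint_eq]
    simp
  have hle : Wᗮ ≤ eigenspace (line H₀ V r) lam := by
    intro u hu
    rw [hb.mem_eigenspace_iff, ← hadj]
    refine ext_inner_right ℂ fun y => ?_
    rw [ContinuousLinearMap.adjoint_inner_left, inner_zero_left]
    exact Submodule.inner_left_of_mem_orthogonal (LinearMap.mem_range_self _ y) hu
  have : CompleteSpace W := hcl.completeSpace_coe
  have hwW : w ∈ W := by
    rw [← W.orthogonal_orthogonal]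
    exact Submodule.orthogonal_le hle hw
  obtain ⟨y, hy⟩ := hwW
  obtain ⟨x, -, hx⟩ := hb.exists_eq r y
  exact ⟨x, hx.trans hy⟩

end IsBasePoint

/-! ### The sliced resolvent -/

theorem subScalar_mem_orthogonal [CompleteSpace E] {T : E →ₗ.[ℂ] E}
    (hT : ∀ x y : T.domain, ⟪T x, (y : E)⟫_ℂ = ⟪(x : E), T y⟫_ℂ) (lam : ℝ) (x : T.domain) :
    subScalar T lam x ∈ (eigenspace T lam)ᗮ := by
  rw [Submodule.mem_orthogonal]
  intro u hu
  obtain ⟨h, h'⟩ := mem_eigenspace_iff.1 hu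
  have := subScalar_symm hT lam ⟨u, h⟩ x
  rw [h', inner_zero_left] at this
  exact this.symm

/-- By symmetry `T` already maps the orthogonal complement of its eigenspace into itself, so the
projection in the compression does nothing. -/
theorem coe_subScalar_compression [CompleteSpace E] {T : E →ₗ.[ℂ] E}
    (hT : ∀ x y : T.domain, ⟪T x, (y : E)⟫_ℂ = ⟪(x : E), T y⟫_ℂ) (lam : ℝ)
    (x : (compression T (eigenspace T lam)ᗮ).domain) :
    ((subScalar (compression T (eigenspace T lam)ᗮ) lam x : ((eigenspace T lam)ᗮ : Submodule ℂ E)) :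
      E) = subScalar T lam ⟨((x : ((eigenspace T lam)ᗮ : Submodule ℂ E)) : E), x.2⟩ := by
  set K := (eigenspace T lam)ᗮ with hK
  have h1 : T ⟨((x : K) : E), x.2⟩ ∈ K := by
    have := K.add_mem (subScalar_mem_orthogonal hT lam ⟨((x : K) : E), x.2⟩)
      (K.smul_mem (lam : ℂ) (x : K).2)
    rwa [subScalar_apply, sub_add_cancel] at this
  change ((K.orthogonalProjectionOnto (T ⟨((x : K) : E), x.2⟩) : K) : E) - (lam : ℂ) • ((x : K) : E) =
    T ⟨((x : K) : E), x.2⟩ - (lam : ℂ) • ((x : K) : E)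
  congr 1
  exact Submodule.starProjection_eq_self_iff.2 h1

theorem IsBasePoint.exists_eq_slicedResolvent [CompleteSpace E] {H₀ V : E →ₗ.[ℂ] E} {lam s₀ : ℝ}
    {G T A : E →L[ℂ] E} (hb : IsBasePoint H₀ V lam s₀ G T A) (hH₀ : IsSelfAdjoint H₀)
    (hV : IsSelfAdjoint V) (r : ℝ) {w : E} (hw : w ∈ (eigenspace (line H₀ V r) lam)ᗮ) :
    ∃ x : (line H₀ V r).domain, (x : E) = slicedResolvent H₀ V lam r w ∧
      subScalar (line H₀ V r) lam x = w := by
  have hsymm := line_symm hH₀ hV r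
  set N := eigenspace (line H₀ V r) lam with hN
  set C := compression (line H₀ V r) Nᗮ with hC
  have hcoe : ∀ x : C.domain, ((subScalar C lam x : (Nᗮ : Submodule ℂ E)) : E) =
      subScalar (line H₀ V r) lam ⟨((x : (Nᗮ : Submodule ℂ E)) : E), x.2⟩ :=
    coe_subScalar_compression hsymm lam
  have hfsymm : ∀ x y : C.domain, ⟪subScalar C lam x, (y : (Nᗮ : Submodule ℂ E))⟫_ℂ =
      ⟪(x : (Nᗮ : Submodule ℂ E)), subScalar C lam y⟫_ℂ := fun x y => by
    rw [Submodule.coe_inner, Submodule.coe_inner, hcoe, hcoe]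
    exact subScalar_symm hsymm lam ⟨_, x.2⟩ ⟨_, y.2⟩
  have hNdom : ∀ u ∈ N, ∃ h : u ∈ (line H₀ V r).domain,
      subScalar (line H₀ V r) lam ⟨u, h⟩ = 0 := fun u hu => Resonance.mem_eigenspace_iff.1 hu
  have hNcl : CompleteSpace N := by
    have : (N : Set E) = ((1 + ((r : ℂ) - s₀) • A : E →L[ℂ] E) : E → E) ⁻¹' {0} := by
      ext x
      exact hb.mem_eigenspace_iff
    have hcl : IsClosed (N : Set E) := by
      rw [this]
      exact isClosed_singleton.preimage (ContinuousLinearMap.continuous _)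
    exact hcl.completeSpace_coe
  -- A kernel vector lies in both `N` and `Nᗮ`; for surjectivity, a solution in the full space is
  -- corrected by subtracting its projection onto `N`.
  have hbij : Function.Bijective (subScalar C (lam : ℂ)) := by
    constructor
    · rw [← LinearMap.ker_eq_bot, LinearMap.ker_eq_bot']
      intro x hx
      have h1 := hcoe x
      rw [hx] at h1
      have h2 : ((x : (Nᗮ : Submodule ℂ E)) : E) ∈ N :=
        Resonance.mem_eigenspace_iff.2 ⟨x.2, h1.symm⟩
      have h3 := Submodule.inner_right_of_mem_orthogonal h2 (x : (Nᗮ : Submodule ℂ E)).2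
      exact Subtype.ext (Subtype.ext (inner_self_eq_zero.1 h3))
    · intro y
      obtain ⟨x, hx⟩ := hb.exists_of_mem_orthogonal r y.2
      obtain ⟨h1, h2⟩ := hNdom _ (N.starProjection_apply_mem (x : E))
      have h3 : (x : E) - N.starProjection x ∈ (line H₀ V r).domain :=
        Submodule.sub_mem _ x.2 h1
      refine ⟨⟨⟨(x : E) - N.starProjection x, N.sub_starProjection_mem_orthogonal x⟩, h3⟩,
        Subtype.ext ?_⟩
      rw [hcoe]
      change subScalar (line H₀ V r) lam (x - ⟨_, h1⟩) = _
      rw [map_sub, hx, h2, sub_zero]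
  obtain ⟨R, hR1, hR2, -⟩ := exists_inverse_of_symmetric (subScalar C (lam : ℂ)) hfsymm hbij
  have hR : IsInverseAt C lam R := ⟨hR1, hR2⟩
  obtain ⟨x, hx, hxw⟩ := hR2 ⟨w, hw⟩
  refine ⟨⟨((x : (Nᗮ : Submodule ℂ E)) : E), x.2⟩, ?_, ?_⟩
  · have h1 : slicedResolvent H₀ V lam r w =
        ((resolvent C lam (Nᗮ.orthogonalProjectionOnto w) : (Nᗮ : Submodule ℂ E)) : E) := rfl
    have h2 : Nᗮ.orthogonalProjectionOnto w = ⟨w, hw⟩ :=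
      Subtype.ext (Submodule.starProjection_eq_self_iff.2 hw)
    rw [h1, hR.resolvent_eq, h2, ← hx]
  · rw [← hcoe, hxw]

end Line

end Resonance

/-! ### The theorem -/

theorem mainTheorem10 {E : Type*} [NormedAddCommGroup E] [InnerProductSpace ℂ E] [CompleteSpace E]
    (H₀ V : E →ₗ.[ℂ] E) (hH₀ : IsSelfAdjoint H₀) (hV : IsSelfAdjoint V)
    (hrel : Resonance.IsRelativelyCompact H₀ V)
    (lam : ℝ) (hlam : (lam : ℂ) ∉ Resonance.essentialSpectrum H₀)
    (hreg : Resonance.IsRegularDirection H₀ V lam)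
    (r : ℝ) (hr : Resonance.IsResonancePoint H₀ V lam r) :
    (∃ ρ : ℝ, Resonance.IsIsolatingRadius H₀ V lam r ρ) ∧
    ∀ χ : E, Resonance.IsResonanceVector H₀ V lam r χ →
      ∃ hχ : χ ∈ V.domain,
        ∀ ρ : ℝ, Resonance.IsIsolatingRadius H₀ V lam r ρ →
          List.TFAE [
            V ⟨χ, hχ⟩ ∈ (Resonance.eigenspace (Resonance.line H₀ V r) lam)ᗮ,
            Resonance.HasDepthAtLeast H₀ V lam r ρ 1 χ,
            Resonance.nilpotentA H₀ V lam r ρ (Resonance.opS H₀ V lam r ⟨χ, hχ⟩) = -χ] ∧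
          (V ⟨χ, hχ⟩ ∈ (Resonance.eigenspace (Resonance.line H₀ V r) lam)ᗮ →
            Resonance.IsResonanceVector H₀ V lam r (Resonance.opS H₀ V lam r ⟨χ, hχ⟩)) := by
  obtain ⟨s₀, hs₀⟩ := hreg
  obtain ⟨G, T, A, hb⟩ := Resonance.exists_isBasePoint hH₀ hV hrel lam hlam s₀ hs₀
  have hσA : IsCompactOperator (((r : ℂ) - s₀) • A : E →L[ℂ] E) :=
    IsCompactOperator.smul (f := A) hb.compact_left _
  obtain ⟨k₀, hk₀, hP⟩ := hσA.exists_isRieszProjection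
  obtain ⟨P, hP⟩ := hP (k₀ + 1) (by omega)
  have hk : 1 < k₀ + 1 := by omega
  set k := k₀ + 1
  have hvec : ∀ χ, Resonance.IsResonanceVector H₀ V lam r χ ↔
      ∃ j : ℕ, ((1 + ((r : ℂ) - s₀) • A) ^ j : E →L[ℂ] E) χ = 0 := fun χ => hb.isResonanceVector_iff hV
  refine ⟨?_, fun χ hχr => ?_⟩
  · have hu := hP.isUnit_reduced hb.compact_left (Or.inr rfl)
    have hcont : Continuous fun s : ℂ => 1 + (s - s₀) • (A * (1 - P)) := by fun_prop
    have hnhds := hcont.continuousAt.preimage_mem_nhds (Units.isOpen.mem_nhds hu)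
    obtain ⟨ρ, hρ, hball⟩ := Metric.nhds_basis_closedBall.mem_iff.1 hnhds
    refine ⟨ρ, hρ, fun s hs hres => ?_⟩
    by_contra hsr
    exact hb.not_isResonancePoint_iff.2
      (fun x hx => hP.injective_of_isUnit_reduced (by omega) hsr (hball hs) x hx) hres
  · obtain ⟨j, hj⟩ := (hvec χ).1 hχr
    have hχ : χ ∈ V.domain := (hb.exists_mem_domain hj r).2
    have hχP : P χ = χ := hP.apply_of_ker j χ hj
    have hextχ : A χ = G (V ⟨χ, hχ⟩) := hb.extends_product ⟨χ, hχ⟩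
    refine ⟨hχ, fun ρ hρ => ?_⟩
    have hnil : Resonance.nilpotentA H₀ V lam r ρ =
        -((1 + ((r : ℂ) - s₀) • A) * rieszInverse A P ((r : ℂ) - s₀) k) :=
      hP.circleIntegral_eq hb.compact_left hk hρ.1
        (fun s hs hsr => hb.isUnit_left fun h => hsr (hρ.2 s hs h))
        (fun s hs hsr => hb.mul_opA hV fun h => hsr (hρ.2 s hs h))
    set B := 1 + ((r : ℂ) - s₀) • A with hB
    set J := rieszInverse A P ((r : ℂ) - s₀) k with hJ
    have hBA : Commute B A := commute_one_add_smul_self A _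
    have hJB : Commute J B := hP.commute_rieszInverse hBA.symm
    have hJA : ∀ x, J (A x) = P x := fun x => by
      rw [← hP.mul_rieszInverse, ← (hP.commute_rieszInverse (Commute.refl A)).eq]
      rfl
    have hsliced : V ⟨χ, hχ⟩ ∈ (Resonance.eigenspace (Resonance.line H₀ V r) lam)ᗮ →
        B (Resonance.opS H₀ V lam r ⟨χ, hχ⟩) = A χ ∧
          (B ^ (j + 1)) (Resonance.opS H₀ V lam r ⟨χ, hχ⟩) = 0 := fun h => by
      obtain ⟨y, hy, hyV⟩ := hb.exists_eq_slicedResolvent hH₀ hV r h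
      have h1 : B (Resonance.opS H₀ V lam r ⟨χ, hχ⟩) = A χ := by
        change B (Resonance.slicedResolvent H₀ V lam r (V ⟨χ, hχ⟩)) = A χ
        rw [← hy, hB, ← hb.inverse_apply, hyV, hextχ]
      refine ⟨h1, ?_⟩
      -- `B` and `A` commute, so one more power of `B` than kills `χ` kills `S_λ χ`.
      rw [pow_succ, mul_apply_eq_comp, h1,
        show (B ^ j) (A χ) = A ((B ^ j) χ) from
          congrArg (fun S : E →L[ℂ] E => S χ) (hBA.pow_left j).eq, hj, map_zero]
    refine ⟨?_, fun h => (hvec _).2 ⟨j + 1, (hsliced h).2⟩⟩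
    tfae_have 1 → 3 := fun h => by
      obtain ⟨h1, h2⟩ := hsliced h
      rw [hnil, ← hJB.eq]
      change -(J (B _)) = -χ
      rw [h1, hJA, hχP]
    tfae_have 3 → 2 := fun h => by
      -- `S_λ χ` is not known here to be a resonance vector; its image under `P` is one, and `𝐀 P =
      -- 𝐀`.
      refine ⟨-P (Resonance.opS H₀ V lam r ⟨χ, hχ⟩), (hvec _).2 ⟨k, ?_⟩, ?_⟩
      · rw [map_neg, show (B ^ k) (P (Resonance.opS H₀ V lam r ⟨χ, hχ⟩)) = 0 from
          congrArg (fun S : E →L[ℂ] E => S (Resonance.opS H₀ V lam r ⟨χ, hχ⟩)) hP.pow_mul, neg_zero]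
      · have h1 : Resonance.nilpotentA H₀ V lam r ρ * P = Resonance.nilpotentA H₀ V lam r ρ := by
          rw [hnil, neg_mul, mul_assoc, hP.rieszInverse_mul_proj]
        rw [pow_one, map_neg, ← mul_apply_eq_comp, h1, h, neg_neg]
    tfae_have 2 → 1 := by
      rintro ⟨χ₁, hχ₁, h⟩
      obtain ⟨i, hi⟩ := (hvec χ₁).1 hχ₁
      have hm := hb.exists_mem_domain hi r
      have h1 : A χ = -(B χ₁) := by
        rw [← h, pow_one, ← mul_apply_eq_comp, hnil, mul_neg, hP.mul_mul_rieszInverse]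
        change -(B (P χ₁)) = _
        rw [hP.apply_of_ker i χ₁ hi]
      have h2 : V ⟨χ, hχ⟩ = -Resonance.subScalar (Resonance.line H₀ V r) lam ⟨χ₁, hm⟩ := by
        refine eq_neg_of_add_eq_zero_left (hb.injective ?_)
        rw [map_add, ← hextχ, hb.inverse_apply r ⟨χ₁, hm⟩, h1, neg_add_cancel]
      rw [h2]
      exact Submodule.neg_mem _
        (Resonance.subScalar_mem_orthogonal (Resonance.line_symm hH₀ hV r) lam _)
    tfae_finish
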